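/- Let $H,U$ be (real or complex) Hilbert spaces and $\theta>0$. Continuity of operator-valued functions is understood strongly: $F\in C(I;L(X,Y))$ means that $t\mapsto F(t)x$ is continuous on $I$ for every $x\in X$. For each $t\in\mathbb R$ let $A(t)$ be a densely defined linear (possibly unbounded) operator in $H$, and let $B\in C(\mathbb R;L(U,H))$, $C\in C(\mathbb R;L(H))$, $Q\in C(\mathbb R;L(U))$, where $A,B,C,Q$ are $\theta$-periodic, $C(t)=C(t)^*\ge 0$, $Q(t)=Q(t)^*\ge 0$, and $Q(t)\ge\varepsilon I$ for all $t$, for some $\varepsilon>0$. An evolution operator on a time set $I$ is a family $V(t,s)\in L(H)$ ($s\le t$ in $I$), strongly continuous in $(t,s)$, with $V(s,s)=I$ and $V(t,r)V(r,s)=V(t,s)$ for $s\le r\le t$. Assume that $A(\cdot)$ generates an evolution operator $U_A$ on $[0,\infty)$: for $0\le s\le t$ and $x\in D(A(s))$ one has $U_A(t,s)x\in D(A(t))$ and $\partial_t U_A(t,s)x=A(t)U_A(t,s)x$ (a right derivative at $t=s$). Assume also that for all large $n$ the Yosida approximations $A_n(t)=n^2(n-A(t))^{-1}-nI$, $t\ge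 0$, exist and generate evolution operators $U_{A_n}$ in the same sense, and that $U_{A_n}(t,s)x\to U_A(t,s)x$ for each $x\in H$, uniformly on $0\le s\le t\le\theta$. For bounded operators $F(t)$, the evolution operator $V$ on $I$ generated by $A(\cdot)+F(\cdot)$ is understood in the mild sense: $$V(t,s)x=U_A(t,s)x+\int_s^t U_A(t,r)F(r)V(r,s)x\,dr\qquad (s\le t \text{ in } I,\ x\in H).$$ Assume that $(A,B)$ is exponentially $\theta$-periodic stabilizable and $(A,C)$ is exponentially $\theta$-periodic detectable: there are $\theta$-periodic $K_1\in C(\mathbb R;L(H,U))$ and $K_2\in C(\mathbb R;L(H))$ such that $A+BK_1$ and $A+K_2C$ generate evolution operators $V$ on $[0,\infty)$ that are exponentially stable, i.e. $\|V(t,s)\|\le M_0e^{-\omega_0(t-s)}$ for all $0\le s\le t$, with constants $M_0,\omega_0>0$. For $T>0$ let $P^T\in C([0,T];L(H))$ be the mild solution of the Riccati equation $$\dot P+A^*P+PA-PBQ^{-1}B^*P+C^*C=0 \ \text{ on } (0,T),\qquad P(T)=0,$$ that is, for all $t\in[0,T]$ and $h\in H$, $$P^T(t)h=-\int_t^T U_A(s,t)^*\big(P^T(s)B(s)Q(s)^{-1}B(s)^*P^T(s)-C(s)^*C(s)\big)U_A(s,t)h\,ds,$$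 and let $U_T$ be the evolution operator on $[0,T]$ generated by $A-BQ^{-1}B^*P^T$. Then there exist constants $M>0$ and $\omega>0$, independent of $T$, such that for every $T>0$ $$\|U_T(t,s)\|\le M e^{-\omega(t-s)}\qquad\text{for all } 0\le s\le t\le T.$$ -/

import Mathlib

open MeasureTheory Set Filter Topology

section PeriodicLQ

/-- `F ∈ C(I; L(E, G))` in the strong sense: `t ↦ F t x` is continuous on `I` for every `x`. -/
def StronglyContinuousOn {𝕜 E G : Type*} [RCLike 𝕜]
    [NormedAddCommGroup E] [InnerProductSpace 𝕜 E] [NormedAddCommGroup G] [InnerProductSpace 𝕜 G]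
    (F : ℝ → E →L[𝕜] G) (I : Set ℝ) : Prop :=
  ∀ x : E, ContinuousOn (fun t => F t x) I

variable {𝕜 H U : Type*} [RCLike 𝕜]
  [NormedAddCommGroup H] [InnerProductSpace 𝕜 H] [CompleteSpace H]
  [NormedAddCommGroup U] [InnerProductSpace 𝕜 U] [CompleteSpace U]

/-- A strongly continuous evolution family `S t s`, for `s ≤ t` in the time set `I`.
The values of `S` at other pairs are irrelevant. -/
structure IsEvolutionFamily (I : Set ℝ) (S : ℝ → ℝ → H →L[𝕜] H) : Prop where
  continuousOn : ∀ x : H, ContinuousOn (fun p : ℝ × ℝ => S p.1 p.2 x)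
    {p : ℝ × ℝ | p.1 ∈ I ∧ p.2 ∈ I ∧ p.2 ≤ p.1}
  self : ∀ s ∈ I, S s s = ContinuousLinearMap.id 𝕜 H
  comp : ∀ s ∈ I, ∀ r ∈ I, ∀ t ∈ I, s ≤ r → r ≤ t → (S t r).comp (S r s) = S t s

/-- `R = (z - L)⁻¹` is the bounded resolvent at `z` of the unbounded operator `L`. -/
def IsResolventAt (L : H →ₗ.[𝕜] H) (z : 𝕜) (R : H →L[𝕜] H) : Prop :=
  (∀ x : H, ∃ hx : R x ∈ L.domain, z • R x - L ⟨R x, hx⟩ = x) ∧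
  ∀ x : L.domain, R (z • (x : H) - L x) = x

/-- Uniform exponential stability of an evolution family on `[0, ∞)`. -/
def IsExponentiallyStable (V : ℝ → ℝ → H →L[𝕜] H) : Prop :=
  ∃ M > (0 : ℝ), ∃ ω > (0 : ℝ), ∀ s t : ℝ, 0 ≤ s → s ≤ t →
    ‖V t s‖ ≤ M * Real.exp (-ω * (t - s))

/-- The bounded operator `B(t) Q(t)⁻¹ B(t)*` on `H`. -/
noncomputable def controlGram (B : ℝ → U →L[𝕜] H) (Q : ℝ → U →L[𝕜] U) (t : ℝ) : H →L[𝕜] H :=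
  (B t).comp ((Ring.inverse (Q t)).comp (ContinuousLinearMap.adjoint (B t)))

/-- The integrand `S(s, t)* (P(s) B(s) Q(s)⁻¹ B(s)* P(s) - C(s)* C(s)) S(s, t) h` of the mild
Riccati equation. -/
noncomputable def riccatiIntegrand (S : ℝ → ℝ → H →L[𝕜] H) (B : ℝ → U →L[𝕜] H)
    (C : ℝ → H →L[𝕜] H) (Q : ℝ → U →L[𝕜] U) (P : ℝ → H →L[𝕜] H) (t : ℝ) (h : H) (s : ℝ) : H :=
  ContinuousLinearMap.adjoint (S s t)
    (((P s).comp ((controlGram B Q s).comp (P s))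
      - (ContinuousLinearMap.adjoint (C s)).comp (C s)) (S s t h))

variable [NormedSpace ℝ H] [IsScalarTower ℝ 𝕜 H]

/-- The unbounded operators `A t` generate the evolution family `S` on `[0, ∞)`:
`∂ₜ S(t, s) = A(t) S(t, s)` on the domain of `A s`, for all `0 ≤ s ≤ t`
(a right derivative when `t = s`). -/
structure Generates (A : ℝ → H →ₗ.[𝕜] H) (S : ℝ → ℝ → H →L[𝕜] H) : Prop where
  isEvolutionFamily : IsEvolutionFamily (Ici 0) S
  hasDeriv : ∀ s t : ℝ, 0 ≤ s → s ≤ t → ∀ x ∈ (A s).domain,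
    ∃ hx : S t s x ∈ (A t).domain,
      HasDerivWithinAt (fun τ : ℝ => S τ s x) (A t ⟨S t s x, hx⟩) (Ici s) t

/-- The Yosida approximations `Aₙ(t) = n² (n - A(t))⁻¹ - n I` exist for all large `n`, generate
evolution families `Sₙ`, and `Sₙ(t, s) x → S(t, s) x` for each `x`, uniformly on
`0 ≤ s ≤ t ≤ θ`. -/
def YosidaApproximable (θ : ℝ) (A : ℝ → H →ₗ.[𝕜] H) (S : ℝ → ℝ → H →L[𝕜] H) : Prop :=
  ∃ (An : ℕ → ℝ → H →L[𝕜] H) (Sn : ℕ → ℝ → ℝ → H →L[𝕜] H),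
    (∀ᶠ n : ℕ in atTop,
      (∀ t : ℝ, 0 ≤ t → ∃ R : H →L[𝕜] H, IsResolventAt (A t) (n : 𝕜) R ∧
        An n t = ((n : 𝕜) ^ 2) • R - (n : 𝕜) • ContinuousLinearMap.id 𝕜 H) ∧
      Generates (fun t => ((An n t : H →L[𝕜] H) : H →ₗ[𝕜] H).toPMap ⊤) (Sn n)) ∧
    ∀ x : H, TendstoUniformlyOn (fun (n : ℕ) (p : ℝ × ℝ) => Sn n p.1 p.2 x)
      (fun p => S p.1 p.2 x) atTop {p : ℝ × ℝ | 0 ≤ p.2 ∧ p.2 ≤ p.1 ∧ p.1 ≤ θ}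

/-- `V` is the evolution family on the time set `I` generated, in the mild sense, by
`A(t) + F(t)`, where `S` is the evolution family generated by `A` and the `F t` are bounded:
`V(t, s) x = S(t, s) x + ∫ₛᵗ S(t, r) F(r) V(r, s) x dr`. -/
structure GeneratesMild (S : ℝ → ℝ → H →L[𝕜] H) (F : ℝ → H →L[𝕜] H) (I : Set ℝ)
    (V : ℝ → ℝ → H →L[𝕜] H) : Prop where
  isEvolutionFamily : IsEvolutionFamily I V
  intervalIntegrable : ∀ s ∈ I, ∀ t ∈ I, s ≤ t → ∀ x : H,
    IntervalIntegrable (fun r => S t r (F r (V r s x))) volume s t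
  duhamel : ∀ s ∈ I, ∀ t ∈ I, s ≤ t → ∀ x : H,
    V t s x = S t s x + ∫ r in s..t, S t r (F r (V r s x))

/-- `(A, B)` is exponentially `θ`-periodic stabilizable: some `θ`-periodic strongly continuous
feedback `K` makes `y' = (A + B K) y` exponentially stable. Here `S` is generated by `A`. -/
def IsPeriodicStabilizable (θ : ℝ) (S : ℝ → ℝ → H →L[𝕜] H) (B : ℝ → U →L[𝕜] H) : Prop :=
  ∃ K : ℝ → H →L[𝕜] U, Function.Periodic K θ ∧ StronglyContinuousOn K univ ∧
    ∃ V : ℝ → ℝ → H →L[𝕜] H,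
      GeneratesMild S (fun t => (B t).comp (K t)) (Ici 0) V ∧ IsExponentiallyStable V

/-- `(A, C)` is exponentially `θ`-periodic detectable: some `θ`-periodic strongly continuous
`K` makes `y' = (A + K C) y` exponentially stable. Here `S` is generated by `A`. -/
def IsPeriodicDetectable (θ : ℝ) (S : ℝ → ℝ → H →L[𝕜] H) (C : ℝ → H →L[𝕜] H) : Prop :=
  ∃ K : ℝ → H →L[𝕜] H, Function.Periodic K θ ∧ StronglyContinuousOn K univ ∧
    ∃ V : ℝ → ℝ → H →L[𝕜] H,
      GeneratesMild S (fun t => (K t).comp (C t)) (Ici 0) V ∧ IsExponentiallyStable V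

/-- `P ∈ C([0, T]; L(H))` is a mild solution of
`P' + A* P + P A - P B Q⁻¹ B* P + C* C = 0`, `P(T) = 0`. -/
structure IsMildRiccatiSolution (S : ℝ → ℝ → H →L[𝕜] H) (B : ℝ → U →L[𝕜] H)
    (C : ℝ → H →L[𝕜] H) (Q : ℝ → U →L[𝕜] U) (T : ℝ) (P : ℝ → H →L[𝕜] H) : Prop where
  stronglyContinuousOn : StronglyContinuousOn P (Icc 0 T)
  terminal : P T = 0
  intervalIntegrable : ∀ t ∈ Icc (0 : ℝ) T, ∀ h : H,
    IntervalIntegrable (riccatiIntegrand S B C Q P t h) volume t T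
  mild : ∀ t ∈ Icc (0 : ℝ) T, ∀ h : H,
    P t h = ContinuousLinearMap.adjoint (S T t) (P T (S T t h))
      - ∫ s in t..T, riccatiIntegrand S B C Q P t h s

end PeriodicLQ

/-!
The value `⟪P x, x⟫` is a Lyapunov function for the closed loop `y' = (A - B Q⁻¹ B* P) y`, and
three estimates, none of which depends on the horizon `T`, turn it into exponential decay.

* Along the closed loop, `⟪P y, y⟫` decreases at the rate of the running cost
  `‖C y‖² + ⟪Q u, u⟫`, where `u = -Q⁻¹ B* P y` (`closedLoop_dissipation`).
* A stabilizing feedback is admissible on every horizon, and its cost bounds the value: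
  `⟪P x, x⟫ ≤ c ‖x‖²` (`value_le_of_stabilizing`).
* With a stabilizing output injection `K`, the closed-loop state solves
  `y' = (A + K C) y + (B u - K C y)`. The unforced part decays, and the forcing term is dominated
  by the running cost, so that
  `‖y t‖² ≤ a e^{-w (t - s)} ‖y s‖² + b (⟪P y, y⟫ (s) - ⟪P y, y⟫ (t))`
  (`norm_sq_closedLoop_le_of_detectable`).

Over a sufficiently long time step, `‖y‖² + b ⟪P y, y⟫` therefore contracts by a fixed factor
(`exists_exp_decay_of_dissipation`).

The first two estimates rest on an energy identity for mild solutions,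
`IsMildRiccatiSolution.re_inner_sub_eq_integral`, and the third on a change of generator,
`IsMildTrajectory.norm_sub_unforced_le`. The functions involved are not differentiable, and the
adjoints `S(t, s)*` and `B(t)*` are only weakly continuous. Both facts are therefore proved from
increments: on a time step of length `δ` the mild formulas give them up to an error `O(δ²)`, and
such errors vanish under subdivision (`le_of_sub_le_mul_sq`). The measurability that remains is that
of `⟪B Q⁻¹ B* p, p⟫` for continuous `p`, which is lower semicontinuous by completing the square.
The symmetry of `P` follows from uniqueness (`IsMildRiccatiSolution.re_inner_comm`).
-/

/-! ### Real-variable estimates -/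

/-- A function on `[s, t]` whose increments are at most quadratic in the step is nonincreasing.
This replaces differentiation where only measurable integrands are available. -/
theorem le_of_sub_le_mul_sq {a : ℝ → ℝ} {s t c : ℝ} (hst : s ≤ t)
    (h : ∀ r r', s ≤ r → r ≤ r' → r' ≤ t → a r' - a r ≤ c * (r' - r) ^ 2) : a t ≤ a s := by
  have key : ∀ n : ℕ, a t ≤ a s + c * (t - s) ^ 2 * ((n : ℝ) + 1)⁻¹ := by
    intro n
    have hn : (0 : ℝ) < (n : ℝ) + 1 := by positivity
    set δ : ℝ := (t - s) / ((n : ℝ) + 1) with hδ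
    have hδ0 : 0 ≤ δ := div_nonneg (by linarith) hn.le
    have hδn : ((n : ℝ) + 1) * δ = t - s := by rw [hδ]; field_simp
    have hind : ∀ k : ℕ, k ≤ n + 1 → a (s + k * δ) ≤ a s + k * (c * δ ^ 2) := by
      intro k
      induction k with
      | zero => intro _; simp
      | succ k ih =>
        intro hk
        have hk' : ((k : ℝ) + 1) ≤ (n : ℝ) + 1 := by exact_mod_cast hk
        have h1 := h (s + k * δ) (s + (k + 1) * δ) (by nlinarith [Nat.cast_nonneg (α := ℝ) k])
          (by nlinarith) (by nlinarith)
        have h2 := ih (by omega)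
        have h3 : s + (k + 1) * δ - (s + k * δ) = δ := by ring
        rw [h3] at h1
        push_cast
        linarith
    have h4 := hind (n + 1) le_rfl
    push_cast at h4
    rw [hδn] at h4
    have h5 : ((n : ℝ) + 1) * (c * δ ^ 2) = c * (t - s) ^ 2 * ((n : ℝ) + 1)⁻¹ := by
      rw [hδ]; field_simp
    rw [h5] at h4
    simpa using h4
  have hlim : Tendsto (fun n : ℕ => a s + c * (t - s) ^ 2 * ((n : ℝ) + 1)⁻¹) atTop
      (𝓝 (a s + c * (t - s) ^ 2 * 0)) := by
    have := tendsto_one_div_add_atTop_nhds_zero_nat (𝕜 := ℝ)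
    simp only [one_div] at this
    exact tendsto_const_nhds.add (this.const_mul _)
  have := ge_of_tendsto' hlim key
  simpa using this

theorem integral_exp_sub_right_le {w : ℝ} (hw : 0 < w) (a b : ℝ) :
    ∫ r in a..b, Real.exp (-w * (b - r)) ≤ w⁻¹ := by
  have h : ∀ r ∈ uIcc a b, HasDerivAt (fun r => w⁻¹ * Real.exp (-w * (b - r)))
      (Real.exp (-w * (b - r))) r := by
    intro r _
    have h1 : HasDerivAt (fun r => -w * (b - r)) w r := by
      simpa using ((hasDerivAt_id r).const_sub b).const_mul (-w)
    have h2 := (h1.exp).const_mul w⁻¹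
    exact h2.congr_deriv (by field_simp)
  rw [intervalIntegral.integral_eq_sub_of_hasDerivAt h
    (Continuous.intervalIntegrable (by fun_prop) _ _)]
  have : 0 ≤ w⁻¹ * Real.exp (-w * (b - a)) := by positivity
  simp only [sub_self, mul_zero, Real.exp_zero]
  linarith

theorem integral_exp_sub_left_le {w : ℝ} (hw : 0 < w) (a b : ℝ) :
    ∫ r in a..b, Real.exp (-w * (r - a)) ≤ w⁻¹ := by
  have h : ∀ r ∈ uIcc a b, HasDerivAt (fun r => -w⁻¹ * Real.exp (-w * (r - a)))
      (Real.exp (-w * (r - a))) r := by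
    intro r _
    have h1 : HasDerivAt (fun r => -w * (r - a)) (-w) r := by
      simpa using ((hasDerivAt_id r).sub_const a).const_mul (-w)
    have h2 := (h1.exp).const_mul (-w⁻¹)
    exact h2.congr_deriv (by field_simp)
  rw [intervalIntegral.integral_eq_sub_of_hasDerivAt h
    (Continuous.intervalIntegrable (by fun_prop) _ _)]
  have : 0 ≤ w⁻¹ * Real.exp (-w * (b - a)) := by positivity
  simp only [sub_self, mul_zero, Real.exp_zero]
  linarith

/-- If `z ≤ l α + β / l` for all `l > 0`, then `z² ≤ 4 α β`. -/
theorem sq_le_of_forall_le_mul_add_div {z α β : ℝ} (hz : 0 ≤ z) (hα : 0 ≤ α) (hβ : 0 < β)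
    (h : ∀ l > (0 : ℝ), z ≤ l * α + β / l) : z ^ 2 ≤ 4 * α * β := by
  rcases hz.eq_or_lt with rfl | hz
  · simp; positivity
  · have h1 := h (2 * β / z) (by positivity)
    have h2 : β / (2 * β / z) = z / 2 := by field_simp
    rw [h2] at h1
    have h3 : z * (2 * β / z * α) = 2 * α * β := by field_simp
    nlinarith

/-- A discrete Lyapunov argument. The function `N + b φ` is comparable to `N`, and over a time step
so long that `a e^{-w τ} ≤ 1/2` it contracts by a factor `κ < 1`. -/
theorem exists_exp_decay_of_dissipation {a b c w : ℝ} (ha : 0 < a) (hb : 0 ≤ b) (hc : 0 ≤ c)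
    (hw : 0 < w) :
    ∃ M > (0 : ℝ), ∃ ω > (0 : ℝ), ∀ (s₀ T : ℝ) (N φ : ℝ → ℝ),
      (∀ t, s₀ ≤ t → t ≤ T → 0 ≤ φ t ∧ φ t ≤ c * N t) →
      (∀ s t, s₀ ≤ s → s ≤ t → t ≤ T →
        N t ≤ a * Real.exp (-w * (t - s)) * N s + b * (φ s - φ t)) →
      ∀ t, s₀ ≤ t → t ≤ T → (∀ t, 0 ≤ N t) →
        N t ≤ M * Real.exp (-ω * (t - s₀)) * N s₀ := by
  have hd : 0 < 1 + b * c := by positivity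
  obtain ⟨τ, hτ, hτa⟩ : ∃ τ > (0 : ℝ), a * Real.exp (-w * τ) ≤ 1 / 2 := by
    have h1 : Tendsto (fun τ : ℝ => a * Real.exp (-(w * τ))) atTop (𝓝 (a * 0)) :=
      (Real.tendsto_exp_neg_atTop_nhds_zero.comp (tendsto_id.const_mul_atTop hw)).const_mul a
    have h2 := h1.eventually (ge_mem_nhds (show a * 0 < 1 / 2 by norm_num))
    obtain ⟨τ, h3, h4⟩ := (h2.and (eventually_gt_atTop 0)).exists
    exact ⟨τ, h4, by simpa using h3⟩
  set κ : ℝ := 1 - 1 / (2 * (1 + b * c)) with hκ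
  have hbc : 0 ≤ b * c := by positivity
  have hinv : 1 / (2 * (1 + b * c)) ≤ 1 / 2 :=
    one_div_le_one_div_of_le (by norm_num) (by linarith)
  have hinv0 : 0 < 1 / (2 * (1 + b * c)) := by positivity
  have hκ0 : 0 < κ := by linarith
  have hκ1 : κ < 1 := by linarith
  have hlog : Real.log κ < 0 := Real.log_neg hκ0 hκ1
  refine ⟨(a + b * c) * (1 + b * c) * κ⁻¹, by positivity, -Real.log κ / τ,
    div_pos (by linarith) hτ, ?_⟩
  intro s₀ T N φ hφ hN t hst htT hN0
  have hstep : ∀ k : ℕ, s₀ + k * τ ≤ T →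
      N (s₀ + k * τ) + b * φ (s₀ + k * τ) ≤ κ ^ k * (N s₀ + b * φ s₀) := by
    intro k
    induction k with
    | zero => intro _; simp
    | succ k ih =>
      intro hk
      push_cast at hk
      have hk0 : s₀ ≤ s₀ + k * τ := by nlinarith [Nat.cast_nonneg (α := ℝ) k]
      have hkT : s₀ + k * τ ≤ T := by nlinarith
      have h1 := hN (s₀ + k * τ) (s₀ + (k + 1) * τ) hk0 (by nlinarith) hk
      have h2 : s₀ + (k + 1) * τ - (s₀ + k * τ) = τ := by ring
      rw [h2] at h1
      obtain ⟨h3, h4⟩ := hφ _ hk0 hkT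
      have h5 := ih hkT
      have h6 := hN0 (s₀ + k * τ)
      have h7 : N (s₀ + (k + 1) * τ) + b * φ (s₀ + (k + 1) * τ)
          ≤ 1 / 2 * N (s₀ + k * τ) + b * φ (s₀ + k * τ) := by nlinarith
      have h8 : 1 / 2 * N (s₀ + k * τ) + b * φ (s₀ + k * τ)
          ≤ κ * (N (s₀ + k * τ) + b * φ (s₀ + k * τ)) := by
        have h9 : N (s₀ + k * τ) + b * φ (s₀ + k * τ) ≤ (1 + b * c) * N (s₀ + k * τ) := by
          nlinarith
        have h10 : 1 / (2 * (1 + b * c)) * (N (s₀ + k * τ) + b * φ (s₀ + k * τ))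
            ≤ 1 / (2 * (1 + b * c)) * ((1 + b * c) * N (s₀ + k * τ)) :=
          mul_le_mul_of_nonneg_left h9 hinv0.le
        have h11 : 1 / (2 * (1 + b * c)) * ((1 + b * c) * N (s₀ + k * τ))
            = 1 / 2 * N (s₀ + k * τ) := by field_simp
        rw [hκ, sub_mul, one_mul]
        linarith
      push_cast
      rw [pow_succ']
      calc _ ≤ _ := h7
        _ ≤ _ := h8
        _ ≤ κ * (κ ^ k * (N s₀ + b * φ s₀)) := mul_le_mul_of_nonneg_left h5 hκ0.le
        _ = _ := by ring
  set k : ℕ := ⌊(t - s₀) / τ⌋₊ with hk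
  have hq0 : 0 ≤ (t - s₀) / τ := div_nonneg (by linarith) hτ.le
  have hk1 : (k : ℝ) ≤ (t - s₀) / τ := Nat.floor_le hq0
  have hk2 : (t - s₀) / τ < k + 1 := Nat.lt_floor_add_one _
  have hk3 : k * τ ≤ t - s₀ := (le_div_iff₀ hτ).1 hk1
  have hk0 : s₀ ≤ s₀ + k * τ := by nlinarith [Nat.cast_nonneg (α := ℝ) k]
  obtain ⟨h3, h4⟩ := hφ _ hk0 (by linarith)
  obtain ⟨h3', h4'⟩ := hφ s₀ le_rfl (by linarith)
  obtain ⟨h3'', -⟩ := hφ t hst htT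
  have h5 := hstep k (by linarith)
  have h1 := hN (s₀ + k * τ) t hk0 (by linarith) htT
  have h6 : Real.exp (-w * (t - (s₀ + k * τ))) ≤ 1 := Real.exp_le_one_iff.2 (by nlinarith)
  have h7 := hN0 (s₀ + k * τ)
  have h8 : a * Real.exp (-w * (t - (s₀ + k * τ))) * N (s₀ + k * τ) ≤ a * 1 * N (s₀ + k * τ) := by
    gcongr
  have h9 : N t ≤ (a + b * c) * (N (s₀ + k * τ) + b * φ (s₀ + k * τ)) := by
    have e1 := mul_le_mul_of_nonneg_left h4 hb
    have e2 := mul_nonneg hb h3''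
    have e3 : 0 ≤ (a + b * c) * (b * φ (s₀ + k * τ)) := by positivity
    linarith
  -- `κ ^ k ≤ κ⁻¹ κ ^ ((t - s₀) / τ)` because `k + 1 > (t - s₀) / τ` and `κ < 1`
  have h10 : κ ^ k ≤ κ⁻¹ * Real.exp (-(-Real.log κ / τ) * (t - s₀)) := by
    have e1 : κ ^ k = κ⁻¹ * κ ^ (k + 1) := by rw [pow_succ]; field_simp
    rw [e1]
    refine mul_le_mul_of_nonneg_left ?_ (by positivity)
    have e2 : κ ^ (k + 1) = Real.exp (((k : ℝ) + 1) * Real.log κ) := by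
      have : ((k : ℝ) + 1) = ((k + 1 : ℕ) : ℝ) := by push_cast; ring
      rw [this, Real.exp_nat_mul, Real.exp_log hκ0]
    rw [e2]
    apply Real.exp_le_exp.2
    have e3 : -(-Real.log κ / τ) * (t - s₀) = (t - s₀) / τ * Real.log κ := by ring
    rw [e3]
    nlinarith
  have h11 : N s₀ + b * φ s₀ ≤ (1 + b * c) * N s₀ := by nlinarith
  have h12 : 0 ≤ N s₀ + b * φ s₀ := by have := hN0 s₀; positivity
  calc N t ≤ _ := h9
    _ ≤ (a + b * c) * (κ ^ k * (N s₀ + b * φ s₀)) := by gcongr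
    _ ≤ (a + b * c) * ((κ⁻¹ * Real.exp (-(-Real.log κ / τ) * (t - s₀)))
        * ((1 + b * c) * N s₀)) := by gcongr
    _ = _ := by ring

/-! ### Strongly continuous operator functions -/

section StronglyContinuous

variable {𝕜 E G : Type*} [RCLike 𝕜]
  [NormedAddCommGroup E] [InnerProductSpace 𝕜 E] [NormedAddCommGroup G] [InnerProductSpace 𝕜 G]

theorem exists_opNorm_bound_of_isCompact [CompleteSpace E] {X : Type*} [TopologicalSpace X]
    {F : X → E →L[𝕜] G} {K : Set X} (hK : IsCompact K)
    (hF : ∀ x, ContinuousOn (fun t => F t x) K) : ∃ c : ℝ, 0 ≤ c ∧ ∀ t ∈ K, ‖F t‖ ≤ c := by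
  obtain ⟨c, hc⟩ := banach_steinhaus (g := fun t : K => F t) (fun x => by
    obtain ⟨c, hc⟩ := hK.exists_bound_of_continuousOn (hF x)
    exact ⟨c, fun t => hc t t.2⟩)
  exact ⟨max c 0, le_max_right _ _, fun t ht => (hc ⟨t, ht⟩).trans (le_max_left _ _)⟩

theorem StronglyContinuousOn.exists_bound_of_periodic [CompleteSpace E] {F : ℝ → E →L[𝕜] G}
    (hF : StronglyContinuousOn F univ) {θ : ℝ} (hθ : 0 < θ) (hper : Function.Periodic F θ) :
    ∃ c : ℝ, 0 ≤ c ∧ ∀ t, ‖F t‖ ≤ c := by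
  obtain ⟨c, hc0, hc⟩ := exists_opNorm_bound_of_isCompact (isCompact_Icc (a := (0 : ℝ)) (b := θ))
    (F := F) (fun x => (hF x).mono (subset_univ _))
  refine ⟨c, hc0, fun t => ?_⟩
  obtain ⟨r, hr, hrt⟩ := hper.exists_mem_Ico₀ hθ t
  rw [hrt]
  exact hc r (Ico_subset_Icc_self hr)

/-- Strong continuity and a uniform bound make `t ↦ F t (y t)` continuous for continuous `y`. -/
theorem StronglyContinuousOn.apply_continuousOn {F : ℝ → E →L[𝕜] G} {I : Set ℝ}
    (hF : StronglyContinuousOn F I) {c : ℝ} (hc : ∀ t ∈ I, ‖F t‖ ≤ c) {y : ℝ → E}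
    (hy : ContinuousOn y I) : ContinuousOn (fun t => F t (y t)) I := by
  intro t₀ ht₀
  have h1 : Tendsto (fun t => F t (y t₀)) (𝓝[I] t₀) (𝓝 (F t₀ (y t₀))) := hF (y t₀) t₀ ht₀
  have h2 : Tendsto (fun t => F t (y t - y t₀)) (𝓝[I] t₀) (𝓝 0) := by
    have h3 : Tendsto (fun t => c * ‖y t - y t₀‖) (𝓝[I] t₀) (𝓝 0) := by
      have h4 : Tendsto (fun t => y t - y t₀) (𝓝[I] t₀) (𝓝 (y t₀ - y t₀)) :=
        (hy t₀ ht₀).sub tendsto_const_nhds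
      rw [sub_self] at h4
      simpa using h4.norm.const_mul c
    refine squeeze_zero_norm' ?_ h3
    filter_upwards [self_mem_nhdsWithin] with t ht
    exact (F t).le_of_opNorm_le (hc t ht) _
  have h5 := h1.add h2
  rw [add_zero] at h5
  refine h5.congr (fun t => ?_)
  rw [map_sub]
  abel

theorem re_inner_intervalIntegral [CompleteSpace E] [NormedSpace ℝ E] {f : ℝ → E} {a b : ℝ}
    (hf : IntervalIntegrable f volume a b) (k : E) :
    RCLike.re (inner 𝕜 k (∫ r in a..b, f r)) = ∫ r in a..b, RCLike.re (inner 𝕜 k (f r)) := by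
  have h1 : IntervalIntegrable (fun r => inner 𝕜 k (f r)) volume a b :=
    ⟨hf.1.const_inner k, hf.2.const_inner k⟩
  have h2 := (innerSL 𝕜 k).intervalIntegral_comp_comm hf
  simp only [innerSL_apply_apply] at h2
  rw [← h2]
  have h3 := (RCLike.reCLM (K := 𝕜)).intervalIntegral_comp_comm h1
  simpa using h3.symm

theorem abs_re_inner_le (x y : E) : |RCLike.re (inner 𝕜 x y)| ≤ ‖x‖ * ‖y‖ :=
  (RCLike.abs_re_le_norm _).trans (norm_inner_le_norm x y)

end StronglyContinuous

/-! ### The control Gramian `B Q⁻¹ B*` -/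

section Gram

variable {𝕜 H U : Type*} [RCLike 𝕜]
  [NormedAddCommGroup H] [InnerProductSpace 𝕜 H] [CompleteSpace H]
  [NormedAddCommGroup U] [InnerProductSpace 𝕜 U] [CompleteSpace U]

theorem isUnit_of_coercive {q : U →L[𝕜] U} {ε : ℝ} (hε : 0 < ε)
    (h : ∀ u, ε * ‖u‖ ^ 2 ≤ RCLike.re (inner 𝕜 (q u) u)) : IsUnit q := by
  refine q.isUnit_of_forall_le_norm_inner_map (c := ε.toNNReal)
    (Real.toNNReal_pos.2 hε) (fun u => ?_)
  have h1 := RCLike.re_le_norm (inner 𝕜 (q u) u)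
  have h2 := h u
  rw [Real.coe_toNNReal _ hε.le]
  linarith

/-- The vector `Q(t)⁻¹ B(t)* p`: up to sign, the optimal control at time `t` for the costate `p`. -/
noncomputable def costateControl (B : ℝ → U →L[𝕜] H) (Q : ℝ → U →L[𝕜] U) (t : ℝ) (p : H) : U :=
  Ring.inverse (Q t) (ContinuousLinearMap.adjoint (B t) p)

theorem controlGram_apply (B : ℝ → U →L[𝕜] H) (Q : ℝ → U →L[𝕜] U) (t : ℝ) (p : H) :
    controlGram B Q t p = B t (costateControl B Q t p) := rfl

variable {B : ℝ → U →L[𝕜] H} {Q : ℝ → U →L[𝕜] U} {ε β : ℝ}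

theorem apply_costateControl (hε : 0 < ε)
    (hQ_ge : ∀ t u, ε * ‖u‖ ^ 2 ≤ RCLike.re (inner 𝕜 (Q t u) u)) (t : ℝ) (p : H) :
    Q t (costateControl B Q t p) = ContinuousLinearMap.adjoint (B t) p := by
  have h := Ring.mul_inverse_cancel _ (isUnit_of_coercive hε (hQ_ge t))
  exact congrArg (fun F : U →L[𝕜] U => F (ContinuousLinearMap.adjoint (B t) p)) h

theorem re_inner_controlGram_self (hε : 0 < ε)
    (hQ_ge : ∀ t u, ε * ‖u‖ ^ 2 ≤ RCLike.re (inner 𝕜 (Q t u) u)) (t : ℝ) (p : H) :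
    RCLike.re (inner 𝕜 p (controlGram B Q t p))
      = RCLike.re (inner 𝕜 (Q t (costateControl B Q t p)) (costateControl B Q t p)) := by
  rw [controlGram_apply, apply_costateControl hε hQ_ge, ContinuousLinearMap.adjoint_inner_left]

theorem norm_sq_costateControl_le (hε : 0 < ε)
    (hQ_ge : ∀ t u, ε * ‖u‖ ^ 2 ≤ RCLike.re (inner 𝕜 (Q t u) u)) (t : ℝ) (p : H) :
    ε * ‖costateControl B Q t p‖ ^ 2 ≤ RCLike.re (inner 𝕜 p (controlGram B Q t p)) := by
  rw [re_inner_controlGram_self hε hQ_ge]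
  exact hQ_ge _ _

theorem inner_controlGram_comm (hε : 0 < ε) (hQ_pos : ∀ t, (Q t).IsPositive)
    (hQ_ge : ∀ t u, ε * ‖u‖ ^ 2 ≤ RCLike.re (inner 𝕜 (Q t u) u)) (t : ℝ) (p k : H) :
    inner 𝕜 (controlGram B Q t p) k = inner 𝕜 p (controlGram B Q t k) := by
  rw [controlGram_apply, controlGram_apply, ← ContinuousLinearMap.adjoint_inner_left,
    ← (B t).adjoint_inner_right, ← apply_costateControl hε hQ_ge, ← apply_costateControl hε hQ_ge]
  exact ((hQ_pos t).1 _ _).symm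

/-- Completing the square: `⟪p, B Q⁻¹ B* p⟫` is the maximum of `2 Re ⟪p, B v⟫ - ⟪Q v, v⟫` over `v`,
attained at `v = Q⁻¹ B* p`. -/
theorem two_mul_re_inner_sub_le (hε : 0 < ε) (hQ_pos : ∀ t, (Q t).IsPositive)
    (hQ_ge : ∀ t u, ε * ‖u‖ ^ 2 ≤ RCLike.re (inner 𝕜 (Q t u) u)) (t : ℝ) (p : H) (v : U) :
    2 * RCLike.re (inner 𝕜 p (B t v)) - RCLike.re (inner 𝕜 (Q t v) v)
      ≤ RCLike.re (inner 𝕜 p (controlGram B Q t p)) := by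
  rw [re_inner_controlGram_self hε hQ_ge, ← ContinuousLinearMap.adjoint_inner_left,
    ← apply_costateControl hε hQ_ge]
  set u := costateControl B Q t p
  have h1 := hQ_ge t (v - u)
  have h2 : 0 ≤ ε * ‖v - u‖ ^ 2 := by positivity
  have h3 : RCLike.re (inner 𝕜 (Q t v) u) = RCLike.re (inner 𝕜 (Q t u) v) := by
    have h4 : inner 𝕜 (Q t v) u = inner 𝕜 v (Q t u) := (hQ_pos t).1 v u
    rw [h4, inner_re_symm]
  simp only [map_sub, inner_sub_left, inner_sub_right] at h1
  linarith

theorem norm_costateControl_le (hε : 0 < ε)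
    (hQ_ge : ∀ t u, ε * ‖u‖ ^ 2 ≤ RCLike.re (inner 𝕜 (Q t u) u)) (hβ : ∀ t, ‖B t‖ ≤ β)
    (t : ℝ) (p : H) : ‖costateControl B Q t p‖ ≤ β / ε * ‖p‖ := by
  have h1 := hQ_ge t (costateControl B Q t p)
  rw [apply_costateControl hε hQ_ge] at h1
  have h2 := (le_abs_self _).trans
    (abs_re_inner_le (𝕜 := 𝕜) (ContinuousLinearMap.adjoint (B t) p) (costateControl B Q t p))
  have h3 : ‖ContinuousLinearMap.adjoint (B t) p‖ ≤ β * ‖p‖ :=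
    ContinuousLinearMap.le_of_opNorm_le _ (by simpa using hβ t) _
  rw [div_mul_eq_mul_div, le_div_iff₀ hε]
  rcases (norm_nonneg (costateControl B Q t p)).eq_or_lt with h0 | h0
  · rw [← h0, zero_mul]
    exact (norm_nonneg _).trans h3
  · have h4 : ε * ‖costateControl B Q t p‖ * ‖costateControl B Q t p‖
        ≤ β * ‖p‖ * ‖costateControl B Q t p‖ := by nlinarith
    linarith [le_of_mul_le_mul_right h4 h0]

theorem norm_controlGram_le (hε : 0 < ε)
    (hQ_ge : ∀ t u, ε * ‖u‖ ^ 2 ≤ RCLike.re (inner 𝕜 (Q t u) u)) (hβ : ∀ t, ‖B t‖ ≤ β) (t : ℝ) :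
    ‖controlGram B Q t‖ ≤ β * (β / ε) := by
  have hβ0 : 0 ≤ β := (norm_nonneg _).trans (hβ 0)
  refine ContinuousLinearMap.opNorm_le_bound _ (by positivity) (fun p => ?_)
  rw [controlGram_apply, mul_assoc]
  exact ((B t).le_of_opNorm_le (hβ t) _).trans
    (mul_le_mul_of_nonneg_left (norm_costateControl_le hε hQ_ge hβ t p) hβ0)

/-- Since `B*` is only weakly continuous, the quadratic form of `B Q⁻¹ B*` need not be continuous
in time. It is a supremum of continuous functions, hence lower semicontinuous and measurable. -/
theorem lowerSemicontinuous_controlGram (hB : StronglyContinuousOn B univ)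
    (hQ : StronglyContinuousOn Q univ) (hε : 0 < ε) (hQ_pos : ∀ t, (Q t).IsPositive)
    (hQ_ge : ∀ t u, ε * ‖u‖ ^ 2 ≤ RCLike.re (inner 𝕜 (Q t u) u))
    {p : ℝ → H} (hp : Continuous p) :
    LowerSemicontinuous (fun r => RCLike.re (inner 𝕜 (p r) (controlGram B Q r (p r)))) := by
  intro r₀ y hy
  -- test with the control that is optimal at time `r₀`, held constant
  set u := costateControl B Q r₀ (p r₀) with hu
  have hcont : Continuous (fun r => 2 * RCLike.re (inner 𝕜 (p r) (B r u))
      - RCLike.re (inner 𝕜 (Q r u) u)) := by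
    have h1 : Continuous fun r => B r u := continuousOn_univ.1 (hB u)
    have h2 : Continuous fun r => Q r u := continuousOn_univ.1 (hQ u)
    exact (continuous_const.mul (RCLike.continuous_re.comp (hp.inner h1))).sub
      (RCLike.continuous_re.comp (h2.inner continuous_const))
  have h0 : y < 2 * RCLike.re (inner 𝕜 (p r₀) (B r₀ u)) - RCLike.re (inner 𝕜 (Q r₀ u) u) := by
    have h1 := re_inner_controlGram_self (B := B) hε hQ_ge r₀ (p r₀)
    rw [← hu] at h1
    have h2 : controlGram B Q r₀ (p r₀) = B r₀ u := rfl
    rw [← h2]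
    linarith
  filter_upwards [hcont.continuousAt.eventually (lt_mem_nhds h0)] with r hr
  exact hr.trans_le (two_mul_re_inner_sub_le hε hQ_pos hQ_ge r (p r) u)

theorem intervalIntegrable_controlGram (hB : StronglyContinuousOn B univ)
    (hQ : StronglyContinuousOn Q univ) (hε : 0 < ε) (hQ_pos : ∀ t, (Q t).IsPositive)
    (hQ_ge : ∀ t u, ε * ‖u‖ ^ 2 ≤ RCLike.re (inner 𝕜 (Q t u) u)) (hβ : ∀ t, ‖B t‖ ≤ β)
    {p : ℝ → H} {a b : ℝ} (hab : a ≤ b) (hp : ContinuousOn p (Icc a b)) :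
    IntervalIntegrable (fun r => RCLike.re (inner 𝕜 (p r) (controlGram B Q r (p r))))
      volume a b := by
  set p' : ℝ → H := IccExtend hab ((Icc a b).domRestrict p) with hp'
  have hp'c : Continuous p' := (continuousOn_iff_continuous_domRestrict.1 hp).Icc_extend'
  have heq : ∀ r ∈ Icc a b, p' r = p r := fun r hr => by
    rw [hp', IccExtend_of_mem _ _ hr, domRestrict_apply]
  have hmeas := (lowerSemicontinuous_controlGram hB hQ hε hQ_pos hQ_ge hp'c).measurable
  obtain ⟨c, hc⟩ := isCompact_Icc.exists_bound_of_continuousOn hp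
  have hbound : ∀ r ∈ Icc a b,
      ‖RCLike.re (inner 𝕜 (p' r) (controlGram B Q r (p' r)))‖ ≤ c * (β * (β / ε) * c) := by
    intro r hr
    have h1 := hc r hr
    have h0 : 0 ≤ c := (norm_nonneg _).trans h1
    rw [← heq r hr] at h1
    have h2 := (controlGram B Q r).le_of_opNorm_le_of_le (norm_controlGram_le hε hQ_ge hβ r) h1
    rw [Real.norm_eq_abs]
    exact (abs_re_inner_le _ _).trans (mul_le_mul h1 h2 (norm_nonneg _) h0)
  have hint : IntervalIntegrable (fun r => RCLike.re (inner 𝕜 (p' r) (controlGram B Q r (p' r))))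
      volume a b := by
    refine (intervalIntegrable_const (c := c * (β * (β / ε) * c))).mono_fun'
      hmeas.aestronglyMeasurable ?_
    rw [uIoc_of_le hab]
    filter_upwards [ae_restrict_mem measurableSet_Ioc] with r hr
    exact hbound r (Ioc_subset_Icc_self hr)
  refine hint.congr (fun r hr => ?_)
  rw [uIoc_of_le hab] at hr
  simp only [heq r (Ioc_subset_Icc_self hr)]

end Gram

/-! ### Mild trajectories -/

section Trajectory

variable {𝕜 H : Type*} [RCLike 𝕜]
  [NormedAddCommGroup H] [InnerProductSpace 𝕜 H]

theorem IsEvolutionFamily.exists_bound [CompleteSpace H] {S : ℝ → ℝ → H →L[𝕜] H} (hS : IsEvolutionFamily (Ici 0) S)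
    (T : ℝ) : ∃ σ : ℝ, 0 ≤ σ ∧ ∀ s t, 0 ≤ s → s ≤ t → t ≤ T → ‖S t s‖ ≤ σ := by
  have hK : IsCompact {p : ℝ × ℝ | 0 ≤ p.2 ∧ p.2 ≤ p.1 ∧ p.1 ≤ T} := by
    refine (isCompact_Icc (a := ((0 : ℝ), (0 : ℝ))) (b := (T, T))).of_isClosed_subset ?_ ?_
    · exact (isClosed_le continuous_const continuous_snd).inter
        ((isClosed_le continuous_snd continuous_fst).inter
          (isClosed_le continuous_fst continuous_const))
    · rintro ⟨t, s⟩ ⟨h1, h2, h3⟩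
      exact ⟨⟨h1.trans h2, h1⟩, ⟨h3, h2.trans h3⟩⟩
  obtain ⟨σ, h0, h⟩ := exists_opNorm_bound_of_isCompact (F := fun p : ℝ × ℝ => S p.1 p.2) hK
    (fun x => (hS.continuousOn x).mono (fun p hp => ⟨hp.1.trans hp.2.1, hp.1, hp.2.1⟩))
  exact ⟨σ, h0, fun s t h1 h2 h3 => h (t, s) ⟨h1, h2, h3⟩⟩

theorem IsEvolutionFamily.apply_apply {I : Set ℝ} {V : ℝ → ℝ → H →L[𝕜] H}
    (hV : IsEvolutionFamily I V) {s r t : ℝ} (hs : s ∈ I) (hr : r ∈ I) (ht : t ∈ I) (hsr : s ≤ r)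
    (hrt : r ≤ t) (x : H) : V t r (V r s x) = V t s x := by
  rw [← hV.comp s hs r hr t ht hsr hrt]; rfl

theorem IsEvolutionFamily.continuousOn_orbit {I : Set ℝ} {V : ℝ → ℝ → H →L[𝕜] H}
    (hV : IsEvolutionFamily I V) {s b : ℝ} (hI : Icc s b ⊆ I) (x : H) :
    ContinuousOn (fun r => V r s x) (Icc s b) := by
  refine (hV.continuousOn x).comp (f := fun r : ℝ => (r, s)) (by fun_prop) (fun r hr => ?_)
  exact ⟨hI hr, hI ⟨le_rfl, hr.1.trans hr.2⟩, hr.1⟩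

variable [NormedSpace ℝ H]

/-- `y` is a mild solution on `[a, b]` of the inhomogeneous equation `y' = A(t) y + f(t)`, where
`S` is the evolution family generated by `A`. The variation of constants formula is required
between any two times of `[a, b]`. -/
structure IsMildTrajectory (S : ℝ → ℝ → H →L[𝕜] H) (f : ℝ → H) (a b : ℝ) (y : ℝ → H) : Prop where
  intervalIntegrable : ∀ t t', a ≤ t → t ≤ t' → t' ≤ b →
    IntervalIntegrable (fun r => S t' r (f r)) volume t t'
  eq_add : ∀ t t', a ≤ t → t ≤ t' → t' ≤ b → y t' = S t' t (y t) + ∫ r in t..t', S t' r (f r)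

theorem GeneratesMild.isMildTrajectory {S V : ℝ → ℝ → H →L[𝕜] H} {F : ℝ → H →L[𝕜] H} {I : Set ℝ}
    (hV : GeneratesMild S F I V) {s b : ℝ} (hI : Icc s b ⊆ I) (x : H) :
    IsMildTrajectory S (fun r => F r (V r s x)) s b (fun r => V r s x) := by
  have key : ∀ t t', s ≤ t → t ≤ t' → t' ≤ b → ∀ r ∈ Icc t t',
      S t' r (F r (V r t (V t s x))) = S t' r (F r (V r s x)) := by
    intro t t' h1 h2 h3 r hr
    rw [hV.isEvolutionFamily.apply_apply (hI ⟨le_rfl, h1.trans (h2.trans h3)⟩)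
      (hI ⟨h1, h2.trans h3⟩) (hI ⟨h1.trans hr.1, hr.2.trans h3⟩) h1 hr.1]
  refine ⟨fun t t' h1 h2 h3 => ?_, fun t t' h1 h2 h3 => ?_⟩
  · refine (hV.intervalIntegrable t (hI ⟨h1, h2.trans h3⟩) t' (hI ⟨h1.trans h2, h3⟩) h2
      (V t s x)).congr (fun r hr => ?_)
    rw [uIoc_of_le h2] at hr
    exact key t t' h1 h2 h3 r (Ioc_subset_Icc_self hr)
  · have h4 := hV.duhamel t (hI ⟨h1, h2.trans h3⟩) t' (hI ⟨h1.trans h2, h3⟩) h2 (V t s x)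
    rw [hV.isEvolutionFamily.apply_apply (hI ⟨le_rfl, h1.trans (h2.trans h3)⟩)
      (hI ⟨h1, h2.trans h3⟩) (hI ⟨h1.trans h2, h3⟩) h1 h2] at h4
    rw [h4]
    congr 1
    refine intervalIntegral.integral_congr (fun r hr => ?_)
    rw [uIcc_of_le h2] at hr
    exact key t t' h1 h2 h3 r hr

theorem norm_intervalIntegral_evolution_le {S : ℝ → ℝ → H →L[𝕜] H} {f : ℝ → H}
    {t t' σ φ : ℝ} (htt : t ≤ t')
    (hσ : ∀ r ∈ Icc t t', ‖S t' r‖ ≤ σ) (hφ : ∀ r ∈ Icc t t', ‖f r‖ ≤ φ) :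
    ‖∫ r in t..t', S t' r (f r)‖ ≤ σ * φ * (t' - t) := by
  have := intervalIntegral.norm_integral_le_of_norm_le_const (a := t) (b := t') (C := σ * φ)
    (f := fun r => S t' r (f r)) (fun r hr => by
      rw [uIoc_of_le htt] at hr
      have hr' := Ioc_subset_Icc_self hr
      exact (S t' r).le_of_opNorm_le_of_le (hσ r hr') (hφ r hr'))
  rwa [abs_of_nonneg (by linarith)] at this

theorem IsMildTrajectory.norm_sub_evolution_le {S : ℝ → ℝ → H →L[𝕜] H} {f : ℝ → H} {a b : ℝ} {y : ℝ → H}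
    (hy : IsMildTrajectory S f a b y) {σ φ : ℝ}
    (hσ : ∀ s t, a ≤ s → s ≤ t → t ≤ b → ‖S t s‖ ≤ σ) (hφ : ∀ r ∈ Icc a b, ‖f r‖ ≤ φ)
    {t t' : ℝ} (h1 : a ≤ t) (h2 : t ≤ t') (h3 : t' ≤ b) :
    ‖y t' - S t' t (y t)‖ ≤ σ * φ * (t' - t) := by
  rw [hy.eq_add t t' h1 h2 h3, add_sub_cancel_left]
  exact norm_intervalIntegral_evolution_le h2
    (fun r hr => hσ r t' (h1.trans hr.1) hr.2 h3)
    (fun r hr => hφ r ⟨h1.trans hr.1, hr.2.trans h3⟩)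

end Trajectory

/-! ### The Riccati equation -/

section Riccati

variable {𝕜 H U : Type*} [RCLike 𝕜]
  [NormedAddCommGroup H] [InnerProductSpace 𝕜 H] [CompleteSpace H]
  [NormedAddCommGroup U] [InnerProductSpace 𝕜 U] [CompleteSpace U]

/-- The bounded part `P B Q⁻¹ B* P - C* C` of the Riccati equation. -/
noncomputable def riccatiWeight (B : ℝ → U →L[𝕜] H) (C : ℝ → H →L[𝕜] H) (Q : ℝ → U →L[𝕜] U)
    (P : ℝ → H →L[𝕜] H) (t : ℝ) : H →L[𝕜] H :=
  (P t).comp ((controlGram B Q t).comp (P t)) - (ContinuousLinearMap.adjoint (C t)).comp (C t)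

variable {S : ℝ → ℝ → H →L[𝕜] H} {B : ℝ → U →L[𝕜] H} {C : ℝ → H →L[𝕜] H} {Q : ℝ → U →L[𝕜] U}
  {P : ℝ → H →L[𝕜] H} {T : ℝ}

theorem inner_riccatiIntegrand (t r : ℝ) (h k : H) :
    inner 𝕜 k (riccatiIntegrand S B C Q P t h r)
      = inner 𝕜 (S r t k) (riccatiWeight B C Q P r (S r t h)) :=
  ContinuousLinearMap.adjoint_inner_right _ _ _

theorem inner_riccatiWeight (t : ℝ) (h k : H) :
    inner 𝕜 k (riccatiWeight B C Q P t h)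
      = inner 𝕜 k (P t (controlGram B Q t (P t h))) - inner 𝕜 (C t k) (C t h) := by
  rw [← ContinuousLinearMap.adjoint_inner_right, ← inner_sub_right]
  rfl

theorem norm_riccatiWeight_le {π γ c : ℝ} {t : ℝ} (hπ : ‖P t‖ ≤ π) (hγ : ‖controlGram B Q t‖ ≤ γ)
    (hc : ‖C t‖ ≤ c) : ‖riccatiWeight B C Q P t‖ ≤ π * (γ * π) + c * c := by
  have hπ0 := (norm_nonneg _).trans hπ
  have hγ0 := (norm_nonneg _).trans hγ
  have hc0 := (norm_nonneg _).trans hc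
  refine (norm_sub_le _ _).trans (add_le_add ?_ ?_)
  · refine (ContinuousLinearMap.opNorm_comp_le _ _).trans
      (mul_le_mul hπ ?_ (norm_nonneg _) hπ0)
    exact (ContinuousLinearMap.opNorm_comp_le _ _).trans (mul_le_mul hγ hπ (norm_nonneg _) hγ0)
  · refine (ContinuousLinearMap.opNorm_comp_le _ _).trans (mul_le_mul ?_ hc (norm_nonneg _) hc0)
    simpa using hc

theorem riccatiIntegrand_comp (hS : IsEvolutionFamily (Ici 0) S) {t t' r : ℝ} (h0 : 0 ≤ t)
    (h1 : t ≤ t') (h2 : t' ≤ r) (h : H) :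
    riccatiIntegrand S B C Q P t h r
      = ContinuousLinearMap.adjoint (S t' t) (riccatiIntegrand S B C Q P t' (S t' t h) r) := by
  have h3 : S r t = (S r t').comp (S t' t) :=
    (hS.comp t h0 t' (h0.trans h1) r (h0.trans (h1.trans h2)) h1 h2).symm
  unfold riccatiIntegrand
  rw [h3, ContinuousLinearMap.adjoint_comp]
  rfl

variable [NormedSpace ℝ H]

theorem IsMildRiccatiSolution.eq_adjoint_sub (hS : IsEvolutionFamily (Ici 0) S)
    (hP : IsMildRiccatiSolution S B C Q T P) {t t' : ℝ} (h0 : 0 ≤ t) (h1 : t ≤ t') (h2 : t' ≤ T)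
    (h : H) :
    P t h = ContinuousLinearMap.adjoint (S t' t) (P t' (S t' t h))
      - ∫ r in t..t', riccatiIntegrand S B C Q P t h r := by
  have hi := hP.intervalIntegrable t ⟨h0, h1.trans h2⟩ h
  have hi' := hP.intervalIntegrable t' ⟨h0.trans h1, h2⟩ (S t' t h)
  have e1 := hP.mild t ⟨h0, h1.trans h2⟩ h
  have e2 := hP.mild t' ⟨h0.trans h1, h2⟩ (S t' t h)
  rw [hP.terminal] at e1 e2
  simp only [zero_apply, map_zero, zero_sub] at e1 e2
  have hsub1 : uIcc t t' ⊆ uIcc t T := by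
    rw [uIcc_of_le h1, uIcc_of_le (h1.trans h2)]; exact Icc_subset_Icc_right h2
  have hsub2 : uIcc t' T ⊆ uIcc t T := by
    rw [uIcc_of_le h2, uIcc_of_le (h1.trans h2)]; exact Icc_subset_Icc_left h1
  have e3 := intervalIntegral.integral_add_adjacent_intervals (hi.mono_set hsub1)
    (hi.mono_set hsub2)
  have e4 : ∫ r in t'..T, riccatiIntegrand S B C Q P t h r
      = ContinuousLinearMap.adjoint (S t' t)
        (∫ r in t'..T, riccatiIntegrand S B C Q P t' (S t' t h) r) := by
    rw [← ContinuousLinearMap.intervalIntegral_comp_comm _ hi']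
    refine intervalIntegral.integral_congr (fun r hr => ?_)
    rw [uIcc_of_le h2] at hr
    exact riccatiIntegrand_comp hS h0 h1 hr.1 h
  rw [e1, e2, ← e3, e4, map_neg]
  abel

theorem IsMildRiccatiSolution.norm_sub_adjoint_le (hS : IsEvolutionFamily (Ici 0) S)
    (hP : IsMildRiccatiSolution S B C Q T P) {σ w : ℝ}
    (hσ : ∀ s t, 0 ≤ s → s ≤ t → t ≤ T → ‖S t s‖ ≤ σ)
    (hw : ∀ t ∈ Icc 0 T, ‖riccatiWeight B C Q P t‖ ≤ w)
    {t t' : ℝ} (h0 : 0 ≤ t) (h1 : t ≤ t') (h2 : t' ≤ T) (h : H) :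
    ‖ContinuousLinearMap.adjoint (S t' t) (P t' (S t' t h)) - P t h‖
      ≤ σ * (w * (σ * ‖h‖)) * (t' - t) := by
  rw [hP.eq_adjoint_sub hS h0 h1 h2 h, sub_sub_cancel]
  have := intervalIntegral.norm_integral_le_of_norm_le_const (a := t) (b := t')
    (C := σ * (w * (σ * ‖h‖))) (f := riccatiIntegrand S B C Q P t h) (fun r hr => by
      rw [uIoc_of_le h1] at hr
      have hSr := hσ t r h0 hr.1.le (hr.2.trans h2)
      refine ContinuousLinearMap.le_of_opNorm_le_of_le _ (by simpa using hSr) ?_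
      exact ContinuousLinearMap.le_of_opNorm_le_of_le _ (hw r ⟨h0.trans hr.1.le, hr.2.trans h2⟩)
        ((S r t).le_of_opNorm_le hSr h))
  rwa [abs_of_nonneg (by linarith)] at this

/-- A mild Riccati solution is symmetric. Its adjoint solves the same equation, and the defect of
symmetry satisfies a linear Volterra inequality. In the norm with weight `exp (2 κ (T - t))` that
inequality halves the defect. -/
theorem IsMildRiccatiSolution.re_inner_comm (hP : IsMildRiccatiSolution S B C Q T P)
    {σ π γ : ℝ} (hσ0 : 0 ≤ σ) (hσ : ∀ s t, 0 ≤ s → s ≤ t → t ≤ T → ‖S t s‖ ≤ σ)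
    (hπ0 : 0 ≤ π) (hπ : ∀ t ∈ Icc 0 T, ‖P t‖ ≤ π) (hγ : ∀ t, ‖controlGram B Q t‖ ≤ γ)
    (hG : ∀ t p k, inner 𝕜 (controlGram B Q t p) k = inner 𝕜 p (controlGram B Q t k))
    {t : ℝ} (ht : t ∈ Icc 0 T) (h k : H) :
    RCLike.re (inner 𝕜 k (P t h)) = RCLike.re (inner 𝕜 h (P t k)) := by
  have hγ0 : 0 ≤ γ := (norm_nonneg _).trans (hγ 0)
  set κ : ℝ := 2 * (γ * π) * σ ^ 2 + 1 with hκ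
  have hκ0 : 0 < κ := by positivity
  set d : ℝ → H → H → ℝ := fun t h k =>
    RCLike.re (inner 𝕜 k (P t h)) - RCLike.re (inner 𝕜 h (P t k)) with hd
  have hweight : ∀ t (a b : H), RCLike.re (inner 𝕜 b (riccatiWeight B C Q P t a))
      - RCLike.re (inner 𝕜 a (riccatiWeight B C Q P t b))
      = d t (controlGram B Q t (P t a)) b - d t (controlGram B Q t (P t b)) a := by
    intro t a b
    rw [inner_riccatiWeight, inner_riccatiWeight, map_sub, map_sub]
    simp only [hd]
    have h1 : RCLike.re (inner 𝕜 (C t b) (C t a)) = RCLike.re (inner 𝕜 (C t a) (C t b)) :=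
      inner_re_symm _ _
    have h2 : RCLike.re (inner 𝕜 (controlGram B Q t (P t a)) (P t b))
        = RCLike.re (inner 𝕜 (controlGram B Q t (P t b)) (P t a)) := by
      rw [hG, inner_re_symm]
    linarith
  have hmain : ∀ n : ℕ, ∀ t ∈ Icc 0 T, ∀ h k : H, |d t h k|
      ≤ 2 * π * (1 / 2) ^ n * Real.exp (2 * κ * (T - t)) * (‖h‖ * ‖k‖) := by
    intro n
    induction n with
    | zero =>
      intro t ht h k
      have hb : ∀ h k : H, |RCLike.re (inner 𝕜 k (P t h))| ≤ π * (‖h‖ * ‖k‖) := by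
        intro h k
        refine (abs_re_inner_le _ _).trans ?_
        have := mul_le_mul_of_nonneg_left ((P t).le_of_opNorm_le (hπ t ht) h) (norm_nonneg k)
        linarith
      have h1 := abs_sub (RCLike.re (inner 𝕜 k (P t h))) (RCLike.re (inner 𝕜 h (P t k)))
      have h2 := hb h k
      have h3 := hb k h
      have h4 : 1 ≤ Real.exp (2 * κ * (T - t)) :=
        Real.one_le_exp (mul_nonneg (by positivity) (by linarith [ht.2]))
      have h5 : 0 ≤ 2 * π * (‖h‖ * ‖k‖) := by positivity
      have h6 := mul_le_mul_of_nonneg_left h4 h5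
      simp only [hd, pow_zero]
      linarith
    | succ n ih =>
      intro t ht h k
      have hi : ∀ h, IntervalIntegrable (riccatiIntegrand S B C Q P t h) volume t T :=
        hP.intervalIntegrable t ht
      have hre : ∀ h k : H, RCLike.re (inner 𝕜 k (P t h))
          = -∫ r in t..T, RCLike.re (inner 𝕜 k (riccatiIntegrand S B C Q P t h r)) := by
        intro h k
        rw [hP.mild t ht h, hP.terminal, ← re_inner_intervalIntegral (hi h) k]
        simp
      have hii : ∀ h k : H, IntervalIntegrable
          (fun r => RCLike.re (inner 𝕜 k (riccatiIntegrand S B C Q P t h r))) volume t T :=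
        fun h k => ⟨((hi h).1.const_inner k).re, ((hi h).2.const_inner k).re⟩
      have heq : d t h k = -∫ r in t..T,
          (RCLike.re (inner 𝕜 k (riccatiIntegrand S B C Q P t h r))
            - RCLike.re (inner 𝕜 h (riccatiIntegrand S B C Q P t k r))) := by
        rw [intervalIntegral.integral_sub (hii h k) (hii k h)]
        simp only [hd]
        rw [hre h k, hre k h]
        ring
      set A : ℝ := 2 * π * (1 / 2) ^ n * κ * (‖h‖ * ‖k‖) with hA
      have hA0 : 0 ≤ A := by positivity
      have hle : ∀ r ∈ Ioc t T, ‖RCLike.re (inner 𝕜 k (riccatiIntegrand S B C Q P t h r))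
            - RCLike.re (inner 𝕜 h (riccatiIntegrand S B C Q P t k r))‖
          ≤ A * Real.exp (2 * κ * (T - r)) := by
        intro r hr
        have hr' : r ∈ Icc 0 T := ⟨ht.1.trans hr.1.le, hr.2⟩
        rw [inner_riccatiIntegrand, inner_riccatiIntegrand, hweight, Real.norm_eq_abs]
        set N : ℝ := 2 * π * (1 / 2) ^ n * Real.exp (2 * κ * (T - r)) with hN
        have hN0 : 0 ≤ N := by positivity
        have hterm : ∀ h k : H, |d r (controlGram B Q r (P r (S r t h))) (S r t k)|
            ≤ N * (γ * π * σ ^ 2 * (‖h‖ * ‖k‖)) := by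
          intro h k
          refine (ih r hr' _ _).trans (mul_le_mul_of_nonneg_left ?_ hN0)
          have hs := hσ t r ht.1 hr.1.le hr.2
          have e1 : ‖controlGram B Q r (P r (S r t h))‖ ≤ γ * (π * (σ * ‖h‖)) :=
            ContinuousLinearMap.le_of_opNorm_le_of_le _ (hγ r)
              (ContinuousLinearMap.le_of_opNorm_le_of_le _ (hπ r hr')
                ((S r t).le_of_opNorm_le hs h))
          have e2 := (S r t).le_of_opNorm_le hs k
          calc _ ≤ γ * (π * (σ * ‖h‖)) * (σ * ‖k‖) :=
                mul_le_mul e1 e2 (norm_nonneg _) (by positivity)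
            _ = _ := by ring
        have h1 := abs_sub (d r (controlGram B Q r (P r (S r t h))) (S r t k))
          (d r (controlGram B Q r (P r (S r t k))) (S r t h))
        have h2 := hterm h k
        have h3 := hterm k h
        have h4 : A * Real.exp (2 * κ * (T - r)) = N * (κ * (‖h‖ * ‖k‖)) := by
          rw [hA, hN]; ring
        have h5 : N * (γ * π * σ ^ 2 * (‖h‖ * ‖k‖)) + N * (γ * π * σ ^ 2 * (‖k‖ * ‖h‖))
            + N * (‖h‖ * ‖k‖) = N * (κ * (‖h‖ * ‖k‖)) := by rw [hκ]; ring
        have h6 : 0 ≤ N * (‖h‖ * ‖k‖) := by positivity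
        rw [h4]
        linarith
      have hint := intervalIntegral.norm_integral_le_of_norm_le (μ := volume) ht.2
        (Eventually.of_forall hle) (Continuous.intervalIntegrable (by fun_prop) _ _)
      have hexp : ∫ r in t..T, A * Real.exp (2 * κ * (T - r))
          ≤ 2 * π * (1 / 2) ^ (n + 1) * Real.exp (2 * κ * (T - t)) * (‖h‖ * ‖k‖) := by
        have hder : ∀ r ∈ uIcc t T, HasDerivAt
            (fun r => -(A / (2 * κ)) * Real.exp (2 * κ * (T - r)))
            (A * Real.exp (2 * κ * (T - r))) r := by
          intro r _
          have h1 : HasDerivAt (fun r => 2 * κ * (T - r)) (-(2 * κ)) r := by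
            simpa using ((hasDerivAt_id r).const_sub T).const_mul (2 * κ)
          exact ((h1.exp).const_mul (-(A / (2 * κ)))).congr_deriv (by field_simp)
        rw [intervalIntegral.integral_eq_sub_of_hasDerivAt hder
          (Continuous.intervalIntegrable (by fun_prop) _ _)]
        have h1 : A / (2 * κ) = 2 * π * (1 / 2) ^ (n + 1) * (‖h‖ * ‖k‖) := by
          rw [hA, pow_succ]; field_simp
        have h2 : 0 ≤ A / (2 * κ) := by positivity
        simp only [sub_self, mul_zero, Real.exp_zero]
        rw [h1] at h2 ⊢
        linarith
      rw [heq, abs_neg]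
      exact hint.trans hexp
  have hlim : Tendsto (fun n : ℕ => 2 * π * (1 / 2) ^ n * Real.exp (2 * κ * (T - t)) * (‖h‖ * ‖k‖))
      atTop (𝓝 (2 * π * 0 * Real.exp (2 * κ * (T - t)) * (‖h‖ * ‖k‖))) :=
    (((tendsto_pow_atTop_nhds_zero_of_lt_one (by norm_num) (by norm_num)).const_mul
      _).mul_const _).mul_const _
  have h0 := ge_of_tendsto' hlim (fun n => hmain n t ht h k)
  have h1 : d t h k = 0 := abs_nonpos_iff.1 (by simpa using h0)
  exact sub_eq_zero.1 h1

end Riccati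

/-! ### The energy identity -/

section Energy

variable {𝕜 H U : Type*} [RCLike 𝕜]
  [NormedAddCommGroup H] [InnerProductSpace 𝕜 H] [CompleteSpace H] [NormedSpace ℝ H]
  [NormedAddCommGroup U] [InnerProductSpace 𝕜 U] [CompleteSpace U]
  {S : ℝ → ℝ → H →L[𝕜] H} {B : ℝ → U →L[𝕜] H} {C : ℝ → H →L[𝕜] H} {Q : ℝ → U →L[𝕜] U}
  {P : ℝ → H →L[𝕜] H} {T : ℝ}

/-- The energy identity for `t ↦ ⟪y t, P t (y t)⟫` along a mild trajectory `y`. On a subinterval of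
length `δ`, the mild formulas for `P` and `y` give the identity up to `O(δ²)`. The point is that
`S(t', r)* P(t') y(t')` differs from `P(r) y(r)` by `O(δ)` in norm, although `S(t', r)*` need not
be strongly continuous; no regularity of the forcing term beyond boundedness is needed. -/
theorem IsMildRiccatiSolution.re_inner_sub_eq_integral (hS : IsEvolutionFamily (Ici 0) S)
    (hP : IsMildRiccatiSolution S B C Q T P) {γ c : ℝ} (hγ : ∀ t, ‖controlGram B Q t‖ ≤ γ)
    (hG : ∀ t p k, inner 𝕜 (controlGram B Q t p) k = inner 𝕜 p (controlGram B Q t k))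
    (hc : ∀ t, ‖C t‖ ≤ c) {a b : ℝ} (ha : 0 ≤ a) (hab : a ≤ b) (hb : b ≤ T) {y f : ℝ → H}
    (hy : IsMildTrajectory S f a b y) {Y F : ℝ} (hY : ∀ r ∈ Icc a b, ‖y r‖ ≤ Y)
    (hF : ∀ r ∈ Icc a b, ‖f r‖ ≤ F)
    (he : IntervalIntegrable (fun r => -RCLike.re (inner 𝕜 (y r) (riccatiWeight B C Q P r (y r)))
      - 2 * RCLike.re (inner 𝕜 (P r (y r)) (f r))) volume a b) :
    RCLike.re (inner 𝕜 (y a) (P a (y a))) - RCLike.re (inner 𝕜 (y b) (P b (y b)))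
      = ∫ r in a..b, (-RCLike.re (inner 𝕜 (y r) (riccatiWeight B C Q P r (y r)))
        - 2 * RCLike.re (inner 𝕜 (P r (y r)) (f r))) := by
  obtain ⟨σ, hσ0, hσ⟩ := hS.exists_bound T
  obtain ⟨π, hπ0, hπ⟩ := exists_opNorm_bound_of_isCompact isCompact_Icc hP.stronglyContinuousOn
  have hsym := fun t ht => hP.re_inner_comm hσ0 hσ hπ0 hπ hγ hG (t := t) ht
  set w : ℝ := π * (γ * π) + c * c
  have hw : ∀ t ∈ Icc 0 T, ‖riccatiWeight B C Q P t‖ ≤ w :=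
    fun t ht => norm_riccatiWeight_le (hπ t ht) (hγ t) (hc t)
  have hw0 : 0 ≤ w := (norm_nonneg _).trans (hw a ⟨ha, hab.trans hb⟩)
  have hY0 : 0 ≤ Y := (norm_nonneg _).trans (hY a ⟨le_rfl, hab⟩)
  have hF0 : 0 ≤ F := (norm_nonneg _).trans (hF a ⟨le_rfl, hab⟩)
  set e : ℝ → ℝ := fun r => -RCLike.re (inner 𝕜 (y r) (riccatiWeight B C Q P r (y r)))
      - 2 * RCLike.re (inner 𝕜 (P r (y r)) (f r)) with he_def
  set φ : ℝ → ℝ := fun r => RCLike.re (inner 𝕜 (y r) (P r (y r))) with hφ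
  have hyσ : ∀ {t t' : ℝ}, a ≤ t → t ≤ t' → t' ≤ b → ‖y t' - S t' t (y t)‖ ≤ σ * F * (t' - t) :=
    fun h1 h2 h3 => hy.norm_sub_evolution_le
      (fun s t h4 h5 h6 => hσ s t (ha.trans h4) h5 (h6.trans hb)) hF h1 h2 h3
  set κ : ℝ := σ * F * (w * Y) + σ * Y * (w * (σ * F))
    + 2 * ((σ * (w * (σ * Y)) + σ * (π * (σ * F))) * F) with hκ
  have hκ0 : 0 ≤ κ := by positivity
  have hstep : ∀ t t', a ≤ t → t ≤ t' → t' ≤ b →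
      |φ t - φ t' - ∫ r in t..t', e r| ≤ (κ + σ * F * (π * (σ * F))) * (t' - t) ^ 2 := by
    intro t t' h1 h2 h3
    have hδ : 0 ≤ t' - t := by linarith
    have ht0 : 0 ≤ t := ha.trans h1
    have ht' : t' ∈ Icc 0 T := ⟨ht0.trans h2, h3.trans hb⟩
    set J : H := y t' - S t' t (y t) with hJ
    have hJn : ‖J‖ ≤ σ * F * (t' - t) := hyσ h1 h2 h3
    have hJi : J = ∫ r in t..t', S t' r (f r) := by
      rw [hJ, hy.eq_add t t' h1 h2 h3, add_sub_cancel_left]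
    have hfi := hy.intervalIntegrable t t' h1 h2 h3
    have hRi : IntervalIntegrable (riccatiIntegrand S B C Q P t (y t)) volume t t' := by
      refine (hP.intervalIntegrable t ⟨ht0, h2.trans ht'.2⟩ (y t)).mono_set ?_
      rw [uIcc_of_le h2, uIcc_of_le (h2.trans ht'.2)]
      exact Icc_subset_Icc_right ht'.2
    have hei : IntervalIntegrable e volume t t' := by
      refine he.mono_set ?_
      rw [uIcc_of_le h2, uIcc_of_le hab]
      exact Icc_subset_Icc h1 h3
    have e1 : φ t = RCLike.re (inner 𝕜 (S t' t (y t)) (P t' (S t' t (y t))))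
        - ∫ r in t..t', RCLike.re (inner 𝕜 (y t) (riccatiIntegrand S B C Q P t (y t) r)) := by
      rw [← re_inner_intervalIntegral hRi]
      simp only [hφ]
      conv_lhs => rw [hP.eq_adjoint_sub hS ht0 h2 ht'.2 (y t)]
      rw [inner_sub_right, map_sub, ContinuousLinearMap.adjoint_inner_right]
    have e2 : S t' t (y t) = y t' - J := by rw [hJ]; abel
    have e3 : RCLike.re (inner 𝕜 (y t' - J) (P t' (y t' - J)))
        = φ t' - 2 * RCLike.re (inner 𝕜 (P t' (y t')) J) + RCLike.re (inner 𝕜 J (P t' J)) := by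
      have h4 := hsym t' ht' J (y t')
      have h5 : RCLike.re (inner 𝕜 (P t' (y t')) J) = RCLike.re (inner 𝕜 J (P t' (y t'))) :=
        inner_re_symm _ _
      simp only [hφ, map_sub, inner_sub_left, inner_sub_right]
      linarith
    have e4 : RCLike.re (inner 𝕜 (P t' (y t')) J)
        = ∫ r in t..t', RCLike.re (inner 𝕜 (P t' (y t')) (S t' r (f r))) := by
      rw [hJi, re_inner_intervalIntegral hfi]
    have i1 : IntervalIntegrable
        (fun r => RCLike.re (inner 𝕜 (y t) (riccatiIntegrand S B C Q P t (y t) r))) volume t t' :=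
      ⟨(hRi.1.const_inner _).re, (hRi.2.const_inner _).re⟩
    have i2 : IntervalIntegrable
        (fun r => RCLike.re (inner 𝕜 (P t' (y t')) (S t' r (f r)))) volume t t' :=
      ⟨(hfi.1.const_inner _).re, (hfi.2.const_inner _).re⟩
    have e5 : φ t - φ t' - ∫ r in t..t', e r = (∫ r in t..t',
        (-RCLike.re (inner 𝕜 (y t) (riccatiIntegrand S B C Q P t (y t) r))
          - 2 * RCLike.re (inner 𝕜 (P t' (y t')) (S t' r (f r))) - e r))
        + RCLike.re (inner 𝕜 J (P t' J)) := by
      have e6 := intervalIntegral.integral_sub (i1.neg.sub (i2.const_mul 2)) hei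
      have e7 := intervalIntegral.integral_sub i1.neg (i2.const_mul 2)
      simp only [Pi.neg_apply, intervalIntegral.integral_neg,
        intervalIntegral.integral_const_mul] at e6 e7
      rw [e6, e7, e1, e2, e3, e4]
      ring
    have hD : ∀ r ∈ uIoc t t',
        ‖-RCLike.re (inner 𝕜 (y t) (riccatiIntegrand S B C Q P t (y t) r))
          - 2 * RCLike.re (inner 𝕜 (P t' (y t')) (S t' r (f r))) - e r‖ ≤ κ * (t' - t) := by
      intro r hr
      rw [uIoc_of_le h2] at hr
      have har : a ≤ r := h1.trans hr.1.le
      have hr0 : r ∈ Icc 0 T := ⟨ha.trans har, hr.2.trans ht'.2⟩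
      have hrab : r ∈ Icc a b := ⟨har, hr.2.trans h3⟩
      have htr := sub_nonneg.2 hr.1.le
      have hrt := sub_nonneg.2 hr.2
      set x : H := S r t (y t) with hx
      set W := riccatiWeight B C Q P r with hW
      have hxn : ‖x‖ ≤ σ * Y := (S r t).le_of_opNorm_le_of_le (hσ t r ht0 hr.1.le hr0.2)
        (hY t ⟨h1, h2.trans h3⟩)
      have hyx : ‖y r - x‖ ≤ σ * F * (t' - t) := (hyσ h1 hr.1.le hrab.2).trans
        (mul_le_mul_of_nonneg_left (by linarith [hr.2]) (by positivity))
      have n1 : |RCLike.re (inner 𝕜 (y r - x) (W (y r)))| ≤ σ * F * (t' - t) * (w * Y) :=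
        (abs_re_inner_le _ _).trans (mul_le_mul hyx (W.le_of_opNorm_le_of_le (hw r hr0) (hY r hrab))
          (norm_nonneg _) (by positivity))
      have n2 : |RCLike.re (inner 𝕜 x (W (y r - x)))| ≤ σ * Y * (w * (σ * F * (t' - t))) :=
        (abs_re_inner_le _ _).trans (mul_le_mul hxn (W.le_of_opNorm_le_of_le (hw r hr0) hyx)
          (norm_nonneg _) (by positivity))
      set v : H := ContinuousLinearMap.adjoint (S t' r) (P t' (y t')) - P r (y r) with hv
      have hSr : ‖S t' r‖ ≤ σ := hσ r t' hr0.1 hr.2 ht'.2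
      have hvn : ‖v‖ ≤ (σ * (w * (σ * Y)) + σ * (π * (σ * F))) * (t' - t) := by
        have v1 : v = (ContinuousLinearMap.adjoint (S t' r) (P t' (S t' r (y r))) - P r (y r))
            + ContinuousLinearMap.adjoint (S t' r) (P t' (y t' - S t' r (y r))) := by
          rw [hv, map_sub, map_sub]; abel
        have v2 := hP.norm_sub_adjoint_le hS hσ hw hr0.1 hr.2 ht'.2 (y r)
        have v3 : σ * (w * (σ * ‖y r‖)) * (t' - r) ≤ σ * (w * (σ * Y)) * (t' - t) := by
          have := hY r hrab
          have : t' - r ≤ t' - t := by linarith [hr.1]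
          gcongr
        have v4 : ‖y t' - S t' r (y r)‖ ≤ σ * F * (t' - t) := (hyσ har hr.2 h3).trans
          (mul_le_mul_of_nonneg_left (by linarith [hr.1]) (by positivity))
        have v5 : ‖ContinuousLinearMap.adjoint (S t' r) (P t' (y t' - S t' r (y r)))‖
            ≤ σ * (π * (σ * F * (t' - t))) :=
          ContinuousLinearMap.le_of_opNorm_le_of_le _ (by simpa using hSr)
            ((P t').le_of_opNorm_le_of_le (hπ t' ht') v4)
        rw [v1]
        refine (norm_add_le _ _).trans ?_
        linarith
      have n3 : |RCLike.re (inner 𝕜 v (f r))|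
          ≤ (σ * (w * (σ * Y)) + σ * (π * (σ * F))) * (t' - t) * F :=
        (abs_re_inner_le _ _).trans (mul_le_mul hvn (hF r hrab) (norm_nonneg _) (by positivity))
      have d1 : -RCLike.re (inner 𝕜 (y t) (riccatiIntegrand S B C Q P t (y t) r))
          - 2 * RCLike.re (inner 𝕜 (P t' (y t')) (S t' r (f r))) - e r
          = RCLike.re (inner 𝕜 (y r - x) (W (y r))) + RCLike.re (inner 𝕜 x (W (y r - x)))
            - 2 * RCLike.re (inner 𝕜 v (f r)) := by
        rw [inner_riccatiIntegrand, ← ContinuousLinearMap.adjoint_inner_left (S t' r)]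
        simp only [he_def, hv, map_sub, inner_sub_left, inner_sub_right]
        ring
      rw [d1, Real.norm_eq_abs]
      rw [abs_le] at n1 n2 n3 ⊢
      constructor <;> rw [hκ] <;> linarith [n1.1, n1.2, n2.1, n2.2, n3.1, n3.2]
    have hI := intervalIntegral.norm_integral_le_of_norm_le_const hD
    rw [abs_of_nonneg hδ, Real.norm_eq_abs] at hI
    have hJJ : |RCLike.re (inner 𝕜 J (P t' J))|
        ≤ σ * F * (t' - t) * (π * (σ * F * (t' - t))) :=
      (abs_re_inner_le _ _).trans (mul_le_mul hJn ((P t').le_of_opNorm_le_of_le (hπ t' ht') hJn)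
        (norm_nonneg _) (by positivity))
    rw [e5]
    refine (abs_add_le _ _).trans ?_
    linarith
  have hint : ∀ r r', a ≤ r → r ≤ r' → r' ≤ b →
      (∫ u in a..r', e u) = (∫ u in a..r, e u) + ∫ u in r..r', e u := by
    intro r r' h1 h2 h3
    refine (intervalIntegral.integral_add_adjacent_intervals (he.mono_set ?_)
      (he.mono_set ?_)).symm
    · rw [uIcc_of_le h1, uIcc_of_le hab]; exact Icc_subset_Icc_right (h2.trans h3)
    · rw [uIcc_of_le h2, uIcc_of_le hab]; exact Icc_subset_Icc h1 h3
  have hup := le_of_sub_le_mul_sq (a := fun r => φ r + ∫ u in a..r, e u)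
    (c := κ + σ * F * (π * (σ * F))) hab
    (fun r r' h1 h2 h3 => by
      have h4 := (abs_le.1 (hstep r r' h1 h2 h3)).1
      rw [hint r r' h1 h2 h3]
      linarith)
  have hlo := le_of_sub_le_mul_sq (a := fun r => -(φ r + ∫ u in a..r, e u))
    (c := κ + σ * F * (π * (σ * F))) hab
    (fun r r' h1 h2 h3 => by
      have h4 := (abs_le.1 (hstep r r' h1 h2 h3)).2
      rw [hint r r' h1 h2 h3]
      linarith)
  simp only [intervalIntegral.integral_same] at hup hlo
  change φ a - φ b = ∫ r in a..b, e r
  linarith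

/-! ### Output injection -/

/-- A mild trajectory `y` of `A` with forcing `f` is one of `A + L` with forcing `f - L y`, and the
variation of constants formula for `A + L` bounds the distance of `y` to the unforced evolution.
Stated with a measurable majorant `m`, the bound needs no measurability of `f`. -/
theorem IsMildTrajectory.norm_sub_unforced_le (hS : IsEvolutionFamily (Ici 0) S)
    {V : ℝ → ℝ → H →L[𝕜] H} {L : ℝ → H →L[𝕜] H} (hV : GeneratesMild S L (Ici 0) V) {M l : ℝ}
    (hM : ∀ s t, 0 ≤ s → s ≤ t → ‖V t s‖ ≤ M) (hl : ∀ t, ‖L t‖ ≤ l) {a b : ℝ} (ha : 0 ≤ a)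
    (hab : a ≤ b) {y f : ℝ → H} (hy : IsMildTrajectory S f a b y) {Y F : ℝ}
    (hY : ∀ r ∈ Icc a b, ‖y r‖ ≤ Y) (hF : ∀ r ∈ Icc a b, ‖f r‖ ≤ F) {m : ℝ → ℝ}
    (hm : IntervalIntegrable m volume a b)
    (hfm : ∀ r ∈ Icc a b, ‖V b r (f r - L r (y r))‖ ≤ m r) :
    ‖y b - V b a (y a)‖ ≤ ∫ r in a..b, m r := by
  obtain ⟨σ, hσ0, hσ⟩ := hS.exists_bound b
  have hM0 : 0 ≤ M := (norm_nonneg _).trans (hM 0 0 le_rfl le_rfl)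
  have hl0 : 0 ≤ l := (norm_nonneg _).trans (hl 0)
  have hY0 : 0 ≤ Y := (norm_nonneg _).trans (hY a ⟨le_rfl, hab⟩)
  have hF0 : 0 ≤ F := (norm_nonneg _).trans (hF a ⟨le_rfl, hab⟩)
  set D : ℝ := F + l * (M * Y) with hD
  have hD0 : 0 ≤ D := by positivity
  set c : ℝ := M * (l * (σ * D)) + M * (σ * (l * (M * D))) with hc
  have hVS : ∀ s t, 0 ≤ s → s ≤ t → t ≤ b → ∀ x : H, ∀ X, ‖x‖ ≤ X →
      ‖V t s x - S t s x‖ ≤ σ * (l * (M * X)) * (t - s) := by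
    intro s t h1 h2 h3 x X hX
    have h4 := hV.isMildTrajectory (s := s) (b := t) (fun r hr => h1.trans hr.1) x
    have h5 := h4.norm_sub_evolution_le (σ := σ) (φ := l * (M * X))
      (fun s' t' h5 h6 h7 => hσ s' t' (h1.trans h5) h6 (h7.trans h3))
      (fun r hr => (L r).le_of_opNorm_le_of_le (hl r)
        ((V r s).le_of_opNorm_le_of_le (hM s r h1 hr.1) hX)) le_rfl h2 le_rfl
    have h6 : V s s x = x := by rw [hV.isEvolutionFamily.self s h1]; rfl
    beta_reduce at h5
    rwa [h6] at h5
  set ψ : ℝ → H := fun r => V b r (y r) with hψ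
  have hstep : ∀ r r', a ≤ r → r ≤ r' → r' ≤ b →
      ‖ψ r' - ψ r‖ ≤ (∫ ρ in r..r', m ρ) + c * (r' - r) ^ 2 := by
    intro r r' h1 h2 h3
    have hr0 : 0 ≤ r := ha.trans h1
    have hr'0 : 0 ≤ r' := hr0.trans h2
    have hyr := hY r ⟨h1, h2.trans h3⟩
    have hVt := hV.isMildTrajectory (s := r) (b := r') (fun ρ hρ => hr0.trans hρ.1) (y r)
    have hVi := hVt.intervalIntegrable r r' le_rfl h2 le_rfl
    have hyi := hy.intervalIntegrable r r' h1 h2 h3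
    have h6 : V r r (y r) = y r := by rw [hV.isEvolutionFamily.self r hr0]; rfl
    have e1 : V r' r (y r) = S r' r (y r) + ∫ ρ in r..r', S r' ρ (L ρ (V ρ r (y r))) := by
      have := hVt.eq_add r r' le_rfl h2 le_rfl
      beta_reduce at this
      rwa [h6] at this
    set d : ℝ → H := fun ρ => f ρ - L ρ (V ρ r (y r)) with hd
    have hdi : IntervalIntegrable (fun ρ => S r' ρ (d ρ)) volume r r' := by
      refine (hyi.sub hVi).congr (fun ρ _ => ?_)
      simp only [hd, map_sub]
    have e2 : ψ r' - ψ r = ∫ ρ in r..r', V b r' (S r' ρ (d ρ)) := by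
      rw [ContinuousLinearMap.intervalIntegral_comp_comm _ hdi]
      have e3 : ∫ ρ in r..r', S r' ρ (d ρ) = y r' - V r' r (y r) := by
        rw [e1, hy.eq_add r r' h1 h2 h3, add_sub_add_left_eq_sub,
          ← intervalIntegral.integral_sub hyi hVi]
        simp only [hd, map_sub]
      rw [e3, map_sub, hV.isEvolutionFamily.apply_apply (t := b) hr0 hr'0 (hr'0.trans h3) h2 h3]
    have hmi : IntervalIntegrable m volume r r' := by
      refine hm.mono_set ?_
      rw [uIcc_of_le h2, uIcc_of_le hab]; exact Icc_subset_Icc h1 h3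
    have hbound : ∀ ρ ∈ Ioc r r', ‖V b r' (S r' ρ (d ρ))‖ ≤ m ρ + c * (r' - r) := by
      intro ρ hρ
      have haρ : a ≤ ρ := h1.trans hρ.1.le
      have hρb : ρ ≤ b := hρ.2.trans h3
      have hρ0 : 0 ≤ ρ := ha.trans haρ
      have hdn : ‖d ρ‖ ≤ D := (norm_sub_le _ _).trans (add_le_add (hF ρ ⟨haρ, hρb⟩)
        ((L ρ).le_of_opNorm_le_of_le (hl ρ)
          ((V ρ r).le_of_opNorm_le_of_le (hM r ρ hr0 hρ.1.le) hyr)))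
      have e3 : V b r' (S r' ρ (d ρ)) = V b ρ (f ρ - L ρ (y ρ))
          + V b ρ (L ρ (y ρ - V ρ r (y r))) - V b r' (V r' ρ (d ρ) - S r' ρ (d ρ)) := by
        rw [map_sub (V b r'),
          hV.isEvolutionFamily.apply_apply (t := b) hρ0 hr'0 (hr'0.trans h3) hρ.2 h3]
        simp only [hd, map_sub]
        abel
      have n1 : ‖y ρ - V ρ r (y r)‖ ≤ σ * D * (r' - r) := by
        have n2 := hy.norm_sub_evolution_le (σ := σ)
          (fun s t h4 h5 h6 => hσ s t (ha.trans h4) h5 h6) hF h1 hρ.1.le hρb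
        have n3 := hVS r ρ hr0 hρ.1.le hρb (y r) Y hyr
        have n4 : y ρ - V ρ r (y r) = (y ρ - S ρ r (y r)) - (V ρ r (y r) - S ρ r (y r)) := by abel
        rw [n4]
        have n5 : σ * D * (ρ - r) ≤ σ * D * (r' - r) :=
          mul_le_mul_of_nonneg_left (by linarith [hρ.2]) (by positivity)
        have n6 : σ * F * (ρ - r) + σ * (l * (M * Y)) * (ρ - r) = σ * D * (ρ - r) := by
          rw [hD]; ring
        exact (norm_sub_le _ _).trans (by linarith)
      have n7 : ‖V b ρ (L ρ (y ρ - V ρ r (y r)))‖ ≤ M * (l * (σ * D * (r' - r))) :=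
        (V b ρ).le_of_opNorm_le_of_le (hM ρ b hρ0 hρb) ((L ρ).le_of_opNorm_le_of_le (hl ρ) n1)
      have n8 : ‖V r' ρ (d ρ) - S r' ρ (d ρ)‖ ≤ σ * (l * (M * D)) * (r' - r) :=
        (hVS ρ r' hρ0 hρ.2 h3 (d ρ) D hdn).trans
          (mul_le_mul_of_nonneg_left (by linarith [hρ.1]) (by positivity))
      have n9 : ‖V b r' (V r' ρ (d ρ) - S r' ρ (d ρ))‖ ≤ M * (σ * (l * (M * D)) * (r' - r)) :=
        (V b r').le_of_opNorm_le_of_le (hM r' b hr'0 h3) n8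
      have n10 := hfm ρ ⟨haρ, hρb⟩
      rw [e3]
      refine (norm_sub_le _ _).trans ((add_le_add_left (norm_add_le _ _) _).trans ?_)
      rw [hc]
      linarith
    rw [e2]
    refine (intervalIntegral.norm_integral_le_of_norm_le h2 (Eventually.of_forall hbound)
      (hmi.add intervalIntegrable_const)).trans ?_
    rw [intervalIntegral.integral_add hmi intervalIntegrable_const,
      intervalIntegral.integral_const, smul_eq_mul]
    linarith
  have hfin := le_of_sub_le_mul_sq (a := fun r => ‖ψ r - ψ a‖ - ∫ u in a..r, m u) (c := c) hab
    (fun r r' h1 h2 h3 => by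
      have h4 := hstep r r' h1 h2 h3
      have h5 : (∫ u in a..r', m u) = (∫ u in a..r, m u) + ∫ u in r..r', m u := by
        refine (intervalIntegral.integral_add_adjacent_intervals (hm.mono_set ?_)
          (hm.mono_set ?_)).symm
        · rw [uIcc_of_le h1, uIcc_of_le hab]; exact Icc_subset_Icc_right (h2.trans h3)
        · rw [uIcc_of_le h2, uIcc_of_le hab]; exact Icc_subset_Icc h1 h3
      have h6 : ‖ψ r' - ψ a‖ ≤ ‖ψ r' - ψ r‖ + ‖ψ r - ψ a‖ := norm_sub_le_norm_sub_add_norm_sub _ _ _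
      rw [h5]
      linarith)
  simp only [intervalIntegral.integral_same, sub_self, norm_zero] at hfin
  have h7 : ψ b = y b := by
    simp only [hψ]
    rw [hV.isEvolutionFamily.self b (ha.trans hab)]; rfl
  rw [h7] at hfin
  linarith

end Energy

/-! ### Cost estimates -/

section Cost

variable {𝕜 H U : Type*} [RCLike 𝕜]
  [NormedAddCommGroup H] [InnerProductSpace 𝕜 H] [CompleteSpace H]
  [NormedAddCommGroup U] [InnerProductSpace 𝕜 U] [CompleteSpace U]
  {S : ℝ → ℝ → H →L[𝕜] H} {B : ℝ → U →L[𝕜] H} {C : ℝ → H →L[𝕜] H} {Q : ℝ → U →L[𝕜] U}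
  {P : ℝ → H →L[𝕜] H} {T : ℝ}

/-- The running cost `‖C x‖² + ⟪Q u, u⟫` at time `r` in the state `x`, under the feedback
`u = -Q⁻¹ B* P x`. -/
noncomputable def closedLoopCost (B : ℝ → U →L[𝕜] H) (C : ℝ → H →L[𝕜] H) (Q : ℝ → U →L[𝕜] U)
    (P : ℝ → H →L[𝕜] H) (r : ℝ) (x : H) : ℝ :=
  ‖C r x‖ ^ 2 + RCLike.re (inner 𝕜 (P r x) (controlGram B Q r (P r x)))

variable {ε : ℝ}

theorem closedLoopCost_nonneg (hε : 0 < ε)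
    (hQ_ge : ∀ t u, ε * ‖u‖ ^ 2 ≤ RCLike.re (inner 𝕜 (Q t u) u)) (r : ℝ) (x : H) :
    0 ≤ closedLoopCost B C Q P r x := by
  have h := norm_sq_costateControl_le (B := B) hε hQ_ge r (P r x)
  have : 0 ≤ ε * ‖costateControl B Q r (P r x)‖ ^ 2 := by positivity
  unfold closedLoopCost
  nlinarith [sq_nonneg ‖C r x‖]

/-- The forcing term seen by the closed loop after output injection is controlled by the running
cost. -/
theorem sq_norm_add_le_closedLoopCost (hε : 0 < ε)
    (hQ_ge : ∀ t u, ε * ‖u‖ ^ 2 ≤ RCLike.re (inner 𝕜 (Q t u) u)) (β k : ℝ) (r : ℝ) (x : H) :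
    (β * ‖costateControl B Q r (P r x)‖ + k * ‖C r x‖) ^ 2
      ≤ 2 * (β ^ 2 / ε + k ^ 2) * closedLoopCost B C Q P r x := by
  have h := norm_sq_costateControl_le (B := B) hε hQ_ge r (P r x)
  unfold closedLoopCost
  set g := RCLike.re (inner 𝕜 (P r x) (controlGram B Q r (P r x)))
  set u := ‖costateControl B Q r (P r x)‖
  set v := ‖C r x‖
  have h1 : (β * u) ^ 2 ≤ β ^ 2 / ε * g := by
    have h2 : (β * u) ^ 2 = β ^ 2 / ε * (ε * u ^ 2) := by field_simp
    rw [h2]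
    exact mul_le_mul_of_nonneg_left h (by positivity)
  have hg : 0 ≤ g := le_trans (by positivity) h
  have h3 : 0 ≤ β ^ 2 / ε * v ^ 2 := by positivity
  have h4 : 0 ≤ k ^ 2 * g := by positivity
  nlinarith [sq_nonneg (β * u - k * v)]

theorem intervalIntegrable_closedLoopCost (hB : StronglyContinuousOn B univ)
    (hQ : StronglyContinuousOn Q univ) (hε : 0 < ε) (hQ_pos : ∀ t, (Q t).IsPositive)
    (hQ_ge : ∀ t u, ε * ‖u‖ ^ 2 ≤ RCLike.re (inner 𝕜 (Q t u) u)) {β : ℝ} (hβ : ∀ t, ‖B t‖ ≤ β)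
    (hC : StronglyContinuousOn C univ) {c : ℝ} (hc : ∀ t, ‖C t‖ ≤ c)
    (hP : StronglyContinuousOn P (Icc 0 T)) {π : ℝ} (hπ : ∀ t ∈ Icc 0 T, ‖P t‖ ≤ π)
    {a b : ℝ} (hab : a ≤ b) (hsub : Icc a b ⊆ Icc 0 T) {y : ℝ → H} (hy : ContinuousOn y (Icc a b)) :
    IntervalIntegrable (fun r => closedLoopCost B C Q P r (y r)) volume a b := by
  have hPy : ContinuousOn (fun r => P r (y r)) (Icc a b) :=
    StronglyContinuousOn.apply_continuousOn (fun x => (hP x).mono hsub)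
      (fun t ht => hπ t (hsub ht)) hy
  have hCy : ContinuousOn (fun r => C r (y r)) (Icc a b) :=
    StronglyContinuousOn.apply_continuousOn (fun x => (hC x).mono (subset_univ _))
      (fun t _ => hc t) hy
  exact ((hCy.norm.pow 2).intervalIntegrable_of_Icc hab).add
    (intervalIntegrable_controlGram hB hQ hε hQ_pos hQ_ge hβ hab hPy)

theorem neg_re_inner_riccatiWeight {t : ℝ}
    (hsym : ∀ h k : H, RCLike.re (inner 𝕜 k (P t h)) = RCLike.re (inner 𝕜 h (P t k))) (x : H) :
    -RCLike.re (inner 𝕜 x (riccatiWeight B C Q P t x))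
      = ‖C t x‖ ^ 2 - RCLike.re (inner 𝕜 (P t x) (controlGram B Q t (P t x))) := by
  rw [inner_riccatiWeight, map_sub, hsym, inner_self_eq_norm_sq, inner_re_symm]
  ring

variable [NormedSpace ℝ H]

/-- Along the closed loop, the decrease of the value `⟪P x, x⟫` is the accumulated running cost. -/
theorem closedLoop_dissipation (hS : IsEvolutionFamily (Ici 0) S)
    (hB : StronglyContinuousOn B univ) (hQ : StronglyContinuousOn Q univ) (hε : 0 < ε)
    (hQ_pos : ∀ t, (Q t).IsPositive)
    (hQ_ge : ∀ t u, ε * ‖u‖ ^ 2 ≤ RCLike.re (inner 𝕜 (Q t u) u)) {β : ℝ} (hβ : ∀ t, ‖B t‖ ≤ β)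
    (hC : StronglyContinuousOn C univ) {c : ℝ} (hc : ∀ t, ‖C t‖ ≤ c)
    (hP : IsMildRiccatiSolution S B C Q T P) {V : ℝ → ℝ → H →L[𝕜] H}
    (hV : GeneratesMild S (fun t => -(controlGram B Q t).comp (P t)) (Icc 0 T) V)
    {s t : ℝ} (hs : 0 ≤ s) (hst : s ≤ t) (ht : t ≤ T) (x : H) :
    IntervalIntegrable (fun r => closedLoopCost B C Q P r (V r s x)) volume s t ∧
    RCLike.re (inner 𝕜 x (P s x)) - RCLike.re (inner 𝕜 (V t s x) (P t (V t s x)))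
      = ∫ r in s..t, closedLoopCost B C Q P r (V r s x) := by
  have hsub : Icc s t ⊆ Icc 0 T := Icc_subset_Icc hs ht
  obtain ⟨σ, hσ0, hσ⟩ := hS.exists_bound T
  obtain ⟨π, hπ0, hπ⟩ := exists_opNorm_bound_of_isCompact isCompact_Icc hP.stronglyContinuousOn
  have hγ := norm_controlGram_le (B := B) hε hQ_ge hβ
  have hG := inner_controlGram_comm (B := B) hε hQ_pos hQ_ge
  have hyc := hV.isEvolutionFamily.continuousOn_orbit hsub x
  obtain ⟨Y, hY⟩ := isCompact_Icc.exists_bound_of_continuousOn hyc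
  have hint := intervalIntegrable_closedLoopCost hB hQ hε hQ_pos hQ_ge hβ hC hc
    hP.stronglyContinuousOn hπ hst hsub hyc
  have heq : ∀ r ∈ Icc s t, closedLoopCost B C Q P r (V r s x)
      = -RCLike.re (inner 𝕜 (V r s x) (riccatiWeight B C Q P r (V r s x)))
        - 2 * RCLike.re (inner 𝕜 (P r (V r s x))
          ((-(controlGram B Q r).comp (P r)) (V r s x))) := by
    intro r hr
    rw [neg_re_inner_riccatiWeight
      (fun h k => hP.re_inner_comm hσ0 hσ hπ0 hπ hγ hG (hsub hr) h k)]
    have h1 : (-(controlGram B Q r).comp (P r)) (V r s x)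
        = -controlGram B Q r (P r (V r s x)) := rfl
    rw [h1, inner_neg_right, map_neg, closedLoopCost]
    ring
  refine ⟨hint, ?_⟩
  have h0 : V s s x = x := by rw [hV.isEvolutionFamily.self s ⟨hs, hst.trans ht⟩]; rfl
  have h1 := hP.re_inner_sub_eq_integral hS hγ hG hc hs hst ht (hV.isMildTrajectory hsub x)
    (F := β * (β / ε) * (π * Y)) hY
    (fun r hr => by
      have h2 : (-(controlGram B Q r).comp (P r)) (V r s x)
        = -controlGram B Q r (P r (V r s x)) := rfl
      rw [h2, norm_neg]
      exact (controlGram B Q r).le_of_opNorm_le_of_le (hγ r)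
        ((P r).le_of_opNorm_le_of_le (hπ r (hsub hr)) (hY r hr)))
    (hint.congr (fun r hr => by
      rw [uIoc_of_le hst] at hr
      exact heq r (Ioc_subset_Icc_self hr)))
  rw [h0] at h1
  rw [h1]
  refine intervalIntegral.integral_congr (fun r hr => ?_)
  rw [uIcc_of_le hst] at hr
  exact (heq r hr).symm

/-- A stabilizing feedback `K` is an admissible control on every horizon, so its cost bounds the
value `⟪P x, x⟫` independently of the horizon. -/
theorem value_le_of_stabilizing (hS : IsEvolutionFamily (Ici 0) S)
    (hB : StronglyContinuousOn B univ) (hQ : StronglyContinuousOn Q univ) (hε : 0 < ε)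
    (hQ_pos : ∀ t, (Q t).IsPositive)
    (hQ_ge : ∀ t u, ε * ‖u‖ ^ 2 ≤ RCLike.re (inner 𝕜 (Q t u) u)) {β : ℝ} (hβ : ∀ t, ‖B t‖ ≤ β)
    (hC : StronglyContinuousOn C univ) {c : ℝ} (hc : ∀ t, ‖C t‖ ≤ c) {q : ℝ} (hq : ∀ t, ‖Q t‖ ≤ q)
    {K : ℝ → H →L[𝕜] U} (hK : StronglyContinuousOn K univ) {k : ℝ} (hk : ∀ t, ‖K t‖ ≤ k)
    {V : ℝ → ℝ → H →L[𝕜] H} (hV : GeneratesMild S (fun t => (B t).comp (K t)) (Ici 0) V)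
    {M ω : ℝ} (hω : 0 < ω) (hM : ∀ s t, 0 ≤ s → s ≤ t → ‖V t s‖ ≤ M * Real.exp (-ω * (t - s)))
    (hP : IsMildRiccatiSolution S B C Q T P) {s : ℝ} (hs : s ∈ Icc 0 T) (x : H) :
    RCLike.re (inner 𝕜 x (P s x)) ≤ (c ^ 2 + q * k ^ 2) * M ^ 2 * (2 * ω)⁻¹ * ‖x‖ ^ 2 := by
  have hsub : Icc s T ⊆ Icc 0 T := Icc_subset_Icc_left hs.1
  have hsub' : Icc s T ⊆ Ici 0 := fun r hr => hs.1.trans hr.1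
  have hc0 : 0 ≤ c := (norm_nonneg _).trans (hc 0)
  have hq0 : 0 ≤ q := (norm_nonneg _).trans (hq 0)
  have hk0 : 0 ≤ k := (norm_nonneg _).trans (hk 0)
  obtain ⟨σ, hσ0, hσ⟩ := hS.exists_bound T
  obtain ⟨π, hπ0, hπ⟩ := exists_opNorm_bound_of_isCompact isCompact_Icc hP.stronglyContinuousOn
  have hγ := norm_controlGram_le (B := B) hε hQ_ge hβ
  have hG := inner_controlGram_comm (B := B) hε hQ_pos hQ_ge
  set z : ℝ → H := fun r => V r s x with hz
  have hzc : ContinuousOn z (Icc s T) := hV.isEvolutionFamily.continuousOn_orbit hsub' x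
  obtain ⟨Y, hY⟩ := isCompact_Icc.exists_bound_of_continuousOn hzc
  have hPz : ContinuousOn (fun r => P r (z r)) (Icc s T) :=
    StronglyContinuousOn.apply_continuousOn (fun x => (hP.stronglyContinuousOn x).mono hsub)
      (fun t ht => hπ t (hsub ht)) hzc
  have hCz : ContinuousOn (fun r => C r (z r)) (Icc s T) :=
    StronglyContinuousOn.apply_continuousOn (fun x => (hC x).mono (subset_univ _))
      (fun t _ => hc t) hzc
  have hKz : ContinuousOn (fun r => K r (z r)) (Icc s T) :=
    StronglyContinuousOn.apply_continuousOn (fun x => (hK x).mono (subset_univ _))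
      (fun t _ => hk t) hzc
  have hBKz : ContinuousOn (fun r => B r (K r (z r))) (Icc s T) :=
    StronglyContinuousOn.apply_continuousOn (fun x => (hB x).mono (subset_univ _))
      (fun t _ => hβ t) hKz
  have heq : ∀ r ∈ Icc s T, ‖C r (z r)‖ ^ 2
        - RCLike.re (inner 𝕜 (P r (z r)) (controlGram B Q r (P r (z r))))
        - 2 * RCLike.re (inner 𝕜 (P r (z r)) (B r (K r (z r))))
      = -RCLike.re (inner 𝕜 (z r) (riccatiWeight B C Q P r (z r)))
        - 2 * RCLike.re (inner 𝕜 (P r (z r)) (((B r).comp (K r)) (z r))) := by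
    intro r hr
    rw [neg_re_inner_riccatiWeight
      (fun h k => hP.re_inner_comm hσ0 hσ hπ0 hπ hγ hG (hsub hr) h k)]
    rfl
  have hint : IntervalIntegrable
      (fun r => -RCLike.re (inner 𝕜 (z r) (riccatiWeight B C Q P r (z r)))
        - 2 * RCLike.re (inner 𝕜 (P r (z r)) (((B r).comp (K r)) (z r)))) volume s T := by
    have h1 : IntervalIntegrable (fun r => ‖C r (z r)‖ ^ 2
        - RCLike.re (inner 𝕜 (P r (z r)) (controlGram B Q r (P r (z r))))
        - 2 * RCLike.re (inner 𝕜 (P r (z r)) (B r (K r (z r))))) volume s T :=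
      (((hCz.norm.pow 2).intervalIntegrable_of_Icc hs.2).sub
        (intervalIntegrable_controlGram hB hQ hε hQ_pos hQ_ge hβ hs.2 hPz)).sub
        ((continuousOn_const.mul (RCLike.continuous_re.comp_continuousOn
          (hPz.inner hBKz))).intervalIntegrable_of_Icc hs.2)
    refine h1.congr (fun r hr => ?_)
    rw [uIoc_of_le hs.2] at hr
    exact heq r (Ioc_subset_Icc_self hr)
  have hE := hP.re_inner_sub_eq_integral hS hγ hG hc hs.1 hs.2 le_rfl
    (hV.isMildTrajectory hsub' x) (F := β * (k * Y)) hY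
    (fun r hr => (B r).le_of_opNorm_le_of_le (hβ r) ((K r).le_of_opNorm_le_of_le (hk r) (hY r hr)))
    hint
  have h0 : V s s x = x := by rw [hV.isEvolutionFamily.self s hs.1]; rfl
  rw [h0, hP.terminal] at hE
  simp only [zero_apply, inner_zero_right, map_zero, sub_zero] at hE
  rw [hE]
  have hle : ∀ r ∈ Icc s T, -RCLike.re (inner 𝕜 (z r) (riccatiWeight B C Q P r (z r)))
        - 2 * RCLike.re (inner 𝕜 (P r (z r)) (((B r).comp (K r)) (z r)))
      ≤ (c ^ 2 + q * k ^ 2) * M ^ 2 * ‖x‖ ^ 2 * Real.exp (-(2 * ω) * (r - s)) := by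
    intro r hr
    rw [← heq r hr]
    -- complete the square at `v = -K z`
    have h1 := two_mul_re_inner_sub_le (B := B) hε hQ_pos hQ_ge r (P r (z r)) (-K r (z r))
    simp only [map_neg, inner_neg_left, inner_neg_right, neg_neg] at h1
    have hzn : ‖z r‖ ≤ M * Real.exp (-ω * (r - s)) * ‖x‖ :=
      (V r s).le_of_opNorm_le (hM s r hs.1 hr.1) x
    have h2 : ‖C r (z r)‖ ≤ c * ‖z r‖ := (C r).le_of_opNorm_le (hc r) _
    have h3 : ‖K r (z r)‖ ≤ k * ‖z r‖ := (K r).le_of_opNorm_le (hk r) _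
    have h4 : RCLike.re (inner 𝕜 (Q r (K r (z r))) (K r (z r))) ≤ q * ‖K r (z r)‖ ^ 2 := by
      refine (le_abs_self _).trans ((abs_re_inner_le _ _).trans ?_)
      have h5 := (Q r).le_of_opNorm_le (hq r) (K r (z r))
      nlinarith [norm_nonneg (K r (z r))]
    have h6 : ‖C r (z r)‖ ^ 2 ≤ (c * ‖z r‖) ^ 2 := by gcongr
    have h7 : q * ‖K r (z r)‖ ^ 2 ≤ q * (k * ‖z r‖) ^ 2 := by gcongr
    have h8 : ‖z r‖ ^ 2 ≤ (M * Real.exp (-ω * (r - s)) * ‖x‖) ^ 2 := by gcongr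
    have h9 : Real.exp (-(2 * ω) * (r - s)) = Real.exp (-ω * (r - s)) ^ 2 := by
      rw [← Real.exp_nat_mul]; congr 1; push_cast; ring
    have h10 : (c ^ 2 + q * k ^ 2) * ‖z r‖ ^ 2
        ≤ (c ^ 2 + q * k ^ 2) * (M * Real.exp (-ω * (r - s)) * ‖x‖) ^ 2 :=
      mul_le_mul_of_nonneg_left h8 (by positivity)
    rw [h9]
    linarith
  refine (intervalIntegral.integral_mono_on hs.2 hint
    (Continuous.intervalIntegrable (by fun_prop) _ _) hle).trans ?_
  rw [intervalIntegral.integral_const_mul]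
  have h11 := mul_le_mul_of_nonneg_left
    (integral_exp_sub_left_le (w := 2 * ω) (by positivity) s T)
    (show 0 ≤ (c ^ 2 + q * k ^ 2) * M ^ 2 * ‖x‖ ^ 2 by positivity)
  linarith

/-- Detectability bounds the closed-loop state by its initial value and the accumulated running
cost. -/
theorem norm_sq_closedLoop_le_of_detectable (hS : IsEvolutionFamily (Ici 0) S)
    (hB : StronglyContinuousOn B univ) (hQ : StronglyContinuousOn Q univ) (hε : 0 < ε)
    (hQ_pos : ∀ t, (Q t).IsPositive)
    (hQ_ge : ∀ t u, ε * ‖u‖ ^ 2 ≤ RCLike.re (inner 𝕜 (Q t u) u)) {β : ℝ} (hβ : ∀ t, ‖B t‖ ≤ β)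
    (hC : StronglyContinuousOn C univ) {c : ℝ} (hc : ∀ t, ‖C t‖ ≤ c)
    {K : ℝ → H →L[𝕜] H} {k : ℝ} (hk : ∀ t, ‖K t‖ ≤ k)
    {V : ℝ → ℝ → H →L[𝕜] H} (hV : GeneratesMild S (fun t => (K t).comp (C t)) (Ici 0) V)
    {M ω : ℝ} (hM0 : 0 < M) (hω : 0 < ω)
    (hM : ∀ s t, 0 ≤ s → s ≤ t → ‖V t s‖ ≤ M * Real.exp (-ω * (t - s)))
    (hP : IsMildRiccatiSolution S B C Q T P) {W : ℝ → ℝ → H →L[𝕜] H}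
    (hW : GeneratesMild S (fun t => -(controlGram B Q t).comp (P t)) (Icc 0 T) W)
    {s t : ℝ} (hs : 0 ≤ s) (hst : s ≤ t) (ht : t ≤ T) (x : H) :
    ‖W t s x‖ ^ 2 ≤ 2 * M ^ 2 * Real.exp (-(2 * ω) * (t - s)) * ‖x‖ ^ 2
      + 4 * (β ^ 2 / ε + k ^ 2) * M ^ 2 * (2 * ω)⁻¹
        * (RCLike.re (inner 𝕜 x (P s x)) - RCLike.re (inner 𝕜 (W t s x) (P t (W t s x)))) := by
  have hsub : Icc s t ⊆ Icc 0 T := Icc_subset_Icc hs ht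
  have hc0 : 0 ≤ c := (norm_nonneg _).trans (hc 0)
  have hk0 : 0 ≤ k := (norm_nonneg _).trans (hk 0)
  obtain ⟨π, hπ0, hπ⟩ := exists_opNorm_bound_of_isCompact isCompact_Icc hP.stronglyContinuousOn
  have hγ := norm_controlGram_le (B := B) hε hQ_ge hβ
  obtain ⟨hint, hD⟩ := closedLoop_dissipation hS hB hQ hε hQ_pos hQ_ge hβ hC hc hP hW hs hst ht x
  rw [hD]
  set y : ℝ → H := fun r => W r s x with hy
  set D : ℝ := ∫ r in s..t, closedLoopCost B C Q P r (y r) with hDdef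
  have hD0 : 0 ≤ D := intervalIntegral.integral_nonneg hst
    (fun r _ => closedLoopCost_nonneg hε hQ_ge r _)
  have hyc : ContinuousOn y (Icc s t) := hW.isEvolutionFamily.continuousOn_orbit hsub x
  obtain ⟨Y, hY⟩ := isCompact_Icc.exists_bound_of_continuousOn hyc
  set κ : ℝ := 2 * (β ^ 2 / ε + k ^ 2) with hκ
  have hκ0 : 0 ≤ κ := by positivity
  have h0 : W s s x = x := by rw [hW.isEvolutionFamily.self s ⟨hs, hst.trans ht⟩]; rfl
  have hF : ∀ r (h : H), (-(controlGram B Q r).comp (P r)) h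
      = -(B r) (costateControl B Q r (P r h)) := fun _ _ => rfl
  have hM1 : ∀ s t, 0 ≤ s → s ≤ t → ‖V t s‖ ≤ M := fun s t h1 h2 => by
    refine (hM s t h1 h2).trans (mul_le_of_le_one_right hM0.le (Real.exp_le_one_iff.2 ?_))
    nlinarith
  have hkc : ∀ r, ‖(K r).comp (C r)‖ ≤ k * c := fun r =>
    (ContinuousLinearMap.opNorm_comp_le _ _).trans
      (mul_le_mul (hk r) (hc r) (norm_nonneg _) hk0)
  -- Cauchy–Schwarz for the convolution, in the form of Young's inequality with a free parameter `l`
  have hyoung : ∀ l > (0 : ℝ), ‖W t s x - V t s x‖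
      ≤ l * (κ * D) + (M ^ 2 * (2 * ω)⁻¹ / 4) / l := by
    intro l hl
    have i1 : IntervalIntegrable (fun r => l * (κ * closedLoopCost B C Q P r (y r)))
        volume s t := (hint.const_mul κ).const_mul l
    have i2 : IntervalIntegrable (fun r => M ^ 2 / (4 * l) * Real.exp (-(2 * ω) * (t - r)))
        volume s t := Continuous.intervalIntegrable (by fun_prop) _ _
    have h1 := (hW.isMildTrajectory hsub x).norm_sub_unforced_le hS hV hM1 hkc hs hst
      (F := β * (β / ε) * (π * Y)) hY
      (fun r hr => by
        have h2 : (-(controlGram B Q r).comp (P r)) (W r s x)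
          = -controlGram B Q r (P r (W r s x)) := rfl
        rw [h2, norm_neg]
        exact (controlGram B Q r).le_of_opNorm_le_of_le (hγ r)
          ((P r).le_of_opNorm_le_of_le (hπ r (hsub hr)) (hY r hr)))
      (i1.add i2)
      (fun r hr => by
        set ζ : ℝ := β * ‖costateControl B Q r (P r (y r))‖ + k * ‖C r (y r)‖ with hζ
        have h2 : ‖(-(controlGram B Q r).comp (P r)) (y r) - ((K r).comp (C r)) (y r)‖ ≤ ζ := by
          rw [hF]
          refine (norm_sub_le _ _).trans (add_le_add ?_ ((K r).le_of_opNorm_le (hk r) _))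
          rw [norm_neg]
          exact (B r).le_of_opNorm_le (hβ r) _
        have h3 := (V t r).le_of_opNorm_le_of_le (hM r t (hs.trans hr.1) hr.2) h2
        have h4 := sq_norm_add_le_closedLoopCost (B := B) (C := C) (P := P) hε hQ_ge β k r (y r)
        rw [← hζ, ← hκ] at h4
        have h9 : Real.exp (-(2 * ω) * (t - r)) = Real.exp (-ω * (t - r)) ^ 2 := by
          rw [← Real.exp_nat_mul]; congr 1; push_cast; ring
        have h10 : M * Real.exp (-ω * (t - r)) * ζ
            ≤ l * ζ ^ 2 + M ^ 2 / (4 * l) * Real.exp (-ω * (t - r)) ^ 2 := by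
          set E := Real.exp (-ω * (t - r))
          have h11 : l * ζ ^ 2 + M ^ 2 / (4 * l) * E ^ 2 - M * E * ζ
              = (2 * l * ζ - M * E) ^ 2 / (4 * l) := by field_simp; ring
          have h12 : 0 ≤ (2 * l * ζ - M * E) ^ 2 / (4 * l) := by positivity
          linarith
        have h13 := mul_le_mul_of_nonneg_left h4 hl.le
        rw [h9]
        exact h3.trans (h10.trans (by linarith)))
    rw [h0, intervalIntegral.integral_add i1 i2, intervalIntegral.integral_const_mul,
      intervalIntegral.integral_const_mul, intervalIntegral.integral_const_mul] at h1
    have h5 := mul_le_mul_of_nonneg_left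
      (integral_exp_sub_right_le (w := 2 * ω) (by positivity) s t)
      (show 0 ≤ M ^ 2 / (4 * l) by positivity)
    have h6 : M ^ 2 / (4 * l) * (2 * ω)⁻¹ = (M ^ 2 * (2 * ω)⁻¹ / 4) / l := by field_simp
    rw [h6] at h5
    exact h1.trans (add_le_add le_rfl h5)
  have hsq := sq_le_of_forall_le_mul_add_div (norm_nonneg _) (by positivity) (by positivity) hyoung
  have hVx : ‖V t s x‖ ≤ M * Real.exp (-ω * (t - s)) * ‖x‖ :=
    (V t s).le_of_opNorm_le (hM s t hs hst) x
  have hVx2 : ‖V t s x‖ ^ 2 ≤ (M * Real.exp (-ω * (t - s)) * ‖x‖) ^ 2 := by gcongr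
  have htri : ‖W t s x‖ ≤ ‖W t s x - V t s x‖ + ‖V t s x‖ := by
    simpa using norm_add_le (W t s x - V t s x) (V t s x)
  have h9 : Real.exp (-(2 * ω) * (t - s)) = Real.exp (-ω * (t - s)) ^ 2 := by
    rw [← Real.exp_nat_mul]; congr 1; push_cast; ring
  have h14 : ‖W t s x‖ ^ 2 ≤ (‖W t s x - V t s x‖ + ‖V t s x‖) ^ 2 := by gcongr
  have h15 := sq_nonneg (‖W t s x - V t s x‖ - ‖V t s x‖)
  rw [h9]
  linarith

end Cost

/-! ### Uniform exponential stability -/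

theorem proposition3p2 {𝕜 H U : Type*} [RCLike 𝕜]
    [NormedAddCommGroup H] [InnerProductSpace 𝕜 H] [CompleteSpace H]
    [NormedSpace ℝ H] [IsScalarTower ℝ 𝕜 H]
    [NormedAddCommGroup U] [InnerProductSpace 𝕜 U] [CompleteSpace U]
    (θ : ℝ) (hθ : 0 < θ)
    (A : ℝ → H →ₗ.[𝕜] H) (hA_per : Function.Periodic A θ)
    (hA_dense : ∀ t, Dense ((A t).domain : Set H))
    (S : ℝ → ℝ → H →L[𝕜] H) (hS : Generates A S) (hS_yosida : YosidaApproximable θ A S)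
    (B : ℝ → U →L[𝕜] H) (hB_per : Function.Periodic B θ) (hB : StronglyContinuousOn B univ)
    (C : ℝ → H →L[𝕜] H) (hC_per : Function.Periodic C θ) (hC : StronglyContinuousOn C univ)
    (hC_pos : ∀ t, (C t).IsPositive)
    (Q : ℝ → U →L[𝕜] U) (hQ_per : Function.Periodic Q θ) (hQ : StronglyContinuousOn Q univ)
    (hQ_pos : ∀ t, (Q t).IsPositive)
    (ε : ℝ) (hε : 0 < ε) (hQ_ge : ∀ t u, ε * ‖u‖ ^ 2 ≤ RCLike.re (inner 𝕜 (Q t u) u))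
    (hstab : IsPeriodicStabilizable θ S B) (hdet : IsPeriodicDetectable θ S C) :
    ∃ M > (0 : ℝ), ∃ ω > (0 : ℝ), ∀ T > (0 : ℝ),
      ∀ P : ℝ → H →L[𝕜] H, IsMildRiccatiSolution S B C Q T P →
      ∀ UT : ℝ → ℝ → H →L[𝕜] H,
        GeneratesMild S (fun t => -(controlGram B Q t).comp (P t)) (Icc 0 T) UT →
        ∀ s t : ℝ, 0 ≤ s → s ≤ t → t ≤ T → ‖UT t s‖ ≤ M * Real.exp (-ω * (t - s)) := by
  have hS' := hS.isEvolutionFamily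
  obtain ⟨β, hβ0, hβ⟩ := hB.exists_bound_of_periodic hθ hB_per
  obtain ⟨c, hc0, hc⟩ := hC.exists_bound_of_periodic hθ hC_per
  obtain ⟨q, hq0, hq⟩ := hQ.exists_bound_of_periodic hθ hQ_per
  obtain ⟨K₁, hK₁per, hK₁, V₁, hV₁, M₁, hM₁, ω₁, hω₁, hbd₁⟩ := hstab
  obtain ⟨K₂, hK₂per, hK₂, V₂, hV₂, M₂, hM₂, ω₂, hω₂, hbd₂⟩ := hdet
  obtain ⟨k₁, hk₁0, hk₁⟩ := hK₁.exists_bound_of_periodic hθ hK₁per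
  obtain ⟨k₂, hk₂0, hk₂⟩ := hK₂.exists_bound_of_periodic hθ hK₂per
  obtain ⟨M, hM, ω, hω, hdecay⟩ := exists_exp_decay_of_dissipation
    (a := 2 * M₂ ^ 2) (b := 4 * (β ^ 2 / ε + k₂ ^ 2) * M₂ ^ 2 * (2 * ω₂)⁻¹)
    (c := (c ^ 2 + q * k₁ ^ 2) * M₁ ^ 2 * (2 * ω₁)⁻¹) (w := 2 * ω₂)
    (by positivity) (by positivity) (by positivity) (by positivity)
  refine ⟨Real.sqrt M, Real.sqrt_pos.2 hM, ω / 2, by positivity, ?_⟩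
  intro T _ P hP UT hUT s t hs hst ht
  refine ContinuousLinearMap.opNorm_le_bound _ (by positivity) (fun x => ?_)
  have hvalue : ∀ r ∈ Icc 0 T, ∀ h : H, 0 ≤ RCLike.re (inner 𝕜 h (P r h)) := by
    intro r hr h
    have h1 := (closedLoop_dissipation hS' hB hQ hε hQ_pos hQ_ge hβ hC hc hP hUT
      hr.1 hr.2 le_rfl h).2
    rw [hP.terminal] at h1
    simp only [zero_apply, inner_zero_right, map_zero, sub_zero] at h1
    rw [h1]
    exact intervalIntegral.integral_nonneg hr.2 (fun r _ => closedLoopCost_nonneg hε hQ_ge r _)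
  have hself : UT s s x = x := by
    rw [hUT.isEvolutionFamily.self s ⟨hs, hst.trans ht⟩]; rfl
  have hmain := hdecay s T (fun r => ‖UT r s x‖ ^ 2)
    (fun r => RCLike.re (inner 𝕜 (UT r s x) (P r (UT r s x))))
    (fun r h1 h2 => ⟨hvalue r ⟨hs.trans h1, h2⟩ _,
      value_le_of_stabilizing hS' hB hQ hε hQ_pos hQ_ge hβ hC hc hq hK₁ hk₁ hV₁ hω₁ hbd₁ hP
        ⟨hs.trans h1, h2⟩ _⟩)
    (fun r r' h1 h2 h3 => by
      have h4 := norm_sq_closedLoop_le_of_detectable hS' hB hQ hε hQ_pos hQ_ge hβ hC hc hk₂ hV₂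
        hM₂ hω₂ hbd₂ hP hUT (hs.trans h1) h2 h3 (UT r s x)
      rwa [hUT.isEvolutionFamily.apply_apply ⟨hs, hst.trans ht⟩
        ⟨hs.trans h1, h2.trans h3⟩ ⟨hs.trans (h1.trans h2), h3⟩ h1 h2] at h4)
    t hst ht (fun r => by positivity)
  beta_reduce at hmain
  rw [hself] at hmain
  have hexp : Real.exp (-ω * (t - s)) = Real.exp (-(ω / 2) * (t - s)) ^ 2 := by
    rw [← Real.exp_nat_mul]; congr 1; push_cast; ring
  refine le_of_sq_le_sq ?_ (by positivity)
  rw [mul_pow, mul_pow, Real.sq_sqrt hM.le, ← hexp]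
  exact hmain
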